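/- Let $D$ be the Weyl algebra over $\mathbb{C}$ in the variables $(x_1,x_2,\eta)$, with $\partial_1=\partial/\partial x_1$, $\partial_2=\partial/\partial x_2$, $\partial_\eta=\partial/\partial\eta$, and let $I\subset D$ be the left ideal generated by \begin{align*} P_1&=4\partial_1\partial_2+2\eta x_2\partial_1+\eta^2x_1, & P_2&=4\partial_2^2+\eta x_1\partial_1+2\eta x_2\partial_2+\eta,\\ P_3&=\eta\partial_2-\partial_1^2, & P_4&=3x_1\partial_1+2x_2\partial_2-4\eta\partial_\eta-1. \end{align*} Let $D_B$ be the Weyl algebra over $\mathbb{C}$ in the variables $(x_1,x_2,y)$. The Borel transform $P\mapsto P_B$ is the algebra homomorphism $D\to D_B$ that fixes $x_1,x_2,\partial_1,\partial_2$ and sends $\eta\mapsto\partial_y$, $\partial_\eta\mapsto -y$. Let $I_B\subset D_B$ be the left ideal generated by the Borel transforms \begin{align*} P_{1,B}&=4\partial_1\partial_2+2x_2\partial_1\partial_y+x_1\partial_y^2, & P_{2,B}&=4\partial_2^2+x_1\partial_1\partial_y+2x_2\partial_2\partial_y+\partial_y,\\ P_{3,B}&=\partial_2\partial_y-\partial_1^2,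 & P_{4,B}&=3x_1\partial_1+2x_2\partial_2+4y\partial_y+3. \end{align*} Then the left $D$-module $M=D/I$ is holonomic of rank $3$, and the left $D_B$-module $M_B=D_B/I_B$ is holonomic of rank $3$. Here a finitely generated left module $N$ over the Weyl algebra in $n$ variables $x=(x_1,\dots,x_n)$ is called holonomic if $N=0$ or its characteristic variety in $\mathbb{C}^{2n}$ (the zero set of the annihilator in $\mathbb{C}[x,\xi]$ of the graded module of a good filtration of $N$, with respect to the order filtration) has dimension $n$, and its rank is $\dim_{\mathbb{C}(x)}\mathbb{C}(x)\otimes_{\mathbb{C}[x]}N$. -/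

import Mathlib

open scoped TensorProduct

/-! ## The Weyl algebra -/

/-- The defining relations of the `n`-th Weyl algebra over `ℂ`; the letter `Sum.inl i` stands for
the variable `x i` and the letter `Sum.inr i` for the derivation `∂/∂(x i)`. -/
inductive WeylRel (n : ℕ) :
    FreeAlgebra ℂ (Fin n ⊕ Fin n) → FreeAlgebra ℂ (Fin n ⊕ Fin n) → Prop
  | x_comm (i j : Fin n) : WeylRel n
      (FreeAlgebra.ι ℂ (Sum.inl i) * FreeAlgebra.ι ℂ (Sum.inl j))
      (FreeAlgebra.ι ℂ (Sum.inl j) * FreeAlgebra.ι ℂ (Sum.inl i))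
  | d_comm (i j : Fin n) : WeylRel n
      (FreeAlgebra.ι ℂ (Sum.inr i) * FreeAlgebra.ι ℂ (Sum.inr j))
      (FreeAlgebra.ι ℂ (Sum.inr j) * FreeAlgebra.ι ℂ (Sum.inr i))
  | d_x (i j : Fin n) : WeylRel n
      (FreeAlgebra.ι ℂ (Sum.inr i) * FreeAlgebra.ι ℂ (Sum.inl j))
      (FreeAlgebra.ι ℂ (Sum.inl j) * FreeAlgebra.ι ℂ (Sum.inr i) + if i = j then 1 else 0)

/-- The Weyl algebra over `ℂ` in `n` variables, by generators and relations. -/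
def WeylAlgebra (n : ℕ) : Type := RingQuot (WeylRel n)

namespace WeylAlgebra

noncomputable instance instRing (n : ℕ) : Ring (WeylAlgebra n) :=
  inferInstanceAs (Ring (RingQuot (WeylRel n)))

noncomputable instance instAlgebra (n : ℕ) : Algebra ℂ (WeylAlgebra n) :=
  inferInstanceAs (Algebra ℂ (RingQuot (WeylRel n)))

/-- The quotient map from the free algebra. -/
noncomputable def mk (n : ℕ) : FreeAlgebra ℂ (Fin n ⊕ Fin n) →ₐ[ℂ] WeylAlgebra n :=
  RingQuot.mkAlgHom ℂ (WeylRel n)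

/-- The variable `x i`, i.e. multiplication by the `i`-th coordinate. -/
noncomputable def x {n : ℕ} (i : Fin n) : WeylAlgebra n := mk n (FreeAlgebra.ι ℂ (Sum.inl i))

/-- The partial derivation with respect to the `i`-th coordinate. -/
noncomputable def d {n : ℕ} (i : Fin n) : WeylAlgebra n := mk n (FreeAlgebra.ι ℂ (Sum.inr i))

theorem x_comm {n : ℕ} (i j : Fin n) : (x i : WeylAlgebra n) * x j = x j * x i := by
  have h := RingQuot.mkAlgHom_rel ℂ (WeylRel.x_comm i j)
  rw [map_mul, map_mul] at h
  exact h

theorem d_comm {n : ℕ} (i j : Fin n) : (d i : WeylAlgebra n) * d j = d j * d i := by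
  have h := RingQuot.mkAlgHom_rel ℂ (WeylRel.d_comm i j)
  rw [map_mul, map_mul] at h
  exact h

theorem d_mul_x {n : ℕ} (i j : Fin n) :
    (d i : WeylAlgebra n) * x j = x j * d i + if i = j then 1 else 0 := by
  have h := RingQuot.mkAlgHom_rel ℂ (WeylRel.d_x i j)
  rw [map_mul, map_add, map_mul, apply_ite (RingQuot.mkAlgHom ℂ (WeylRel n)), map_one,
    map_zero] at h
  exact h

/-- The universal property: elements `a i`, `b i` of a `ℂ`-algebra that satisfy the Weyl relations
define an algebra homomorphism with `x i ↦ a i` and `d i ↦ b i`. -/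
noncomputable def lift {n : ℕ} {A : Type*} [Ring A] [Algebra ℂ A] (a b : Fin n → A)
    (ha : ∀ i j, a i * a j = a j * a i) (hb : ∀ i j, b i * b j = b j * b i)
    (hba : ∀ i j, b i * a j = a j * b i + if i = j then 1 else 0) : WeylAlgebra n →ₐ[ℂ] A :=
  RingQuot.liftAlgHom ℂ ⟨FreeAlgebra.lift ℂ (Sum.elim a b), by
    intro u v h
    cases h with
    | x_comm i j => simpa using ha i j
    | d_comm i j => simpa using hb i j
    | d_x i j =>
      have h := hba i j
      by_cases hij : i = j
      · simpa [hij] using h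
      · simpa [hij] using h⟩

theorem lift_x {n : ℕ} {A : Type*} [Ring A] [Algebra ℂ A] (a b : Fin n → A)
    (ha : ∀ i j, a i * a j = a j * a i) (hb : ∀ i j, b i * b j = b j * b i)
    (hba : ∀ i j, b i * a j = a j * b i + if i = j then 1 else 0) (i : Fin n) :
    lift a b ha hb hba (x i) = a i := by
  have h : lift a b ha hb hba (x i) = FreeAlgebra.lift ℂ (Sum.elim a b)
      (FreeAlgebra.ι ℂ (Sum.inl i)) := RingQuot.liftAlgHom_mkAlgHom_apply ..
  simpa using h

theorem lift_d {n : ℕ} {A : Type*} [Ring A] [Algebra ℂ A] (a b : Fin n → A)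
    (ha : ∀ i j, a i * a j = a j * a i) (hb : ∀ i j, b i * b j = b j * b i)
    (hba : ∀ i j, b i * a j = a j * b i + if i = j then 1 else 0) (i : Fin n) :
    lift a b ha hb hba (d i) = b i := by
  have h : lift a b ha hb hba (d i) = FreeAlgebra.lift ℂ (Sum.elim a b)
      (FreeAlgebra.ι ℂ (Sum.inr i)) := RingQuot.liftAlgHom_mkAlgHom_apply ..
  simpa using h

/-! ## Polynomials in the Weyl algebra -/

/-- Evaluation of complex polynomials at a commuting family of elements of a `ℂ`-algebra that need
not be commutative. -/
noncomputable def commEval {n : ℕ} {A : Type*} [Ring A] [Algebra ℂ A] (f : Fin n → A)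
    (hf : ∀ i j, f i * f j = f j * f i) : MvPolynomial (Fin n) ℂ →ₐ[ℂ] A :=
  letI : CommRing (Algebra.adjoin ℂ (Set.range f)) :=
    { (Algebra.adjoin ℂ (Set.range f)).toRing with
      mul_comm := (Algebra.isMulCommutative_adjoin ℂ (by
        rintro _ ⟨i, rfl⟩ _ ⟨j, rfl⟩
        exact hf i j)).is_comm.comm }
  (Algebra.adjoin ℂ (Set.range f)).val.comp
    (MvPolynomial.aeval fun i => ⟨f i, Algebra.subset_adjoin ⟨i, rfl⟩⟩)

theorem commEval_X {n : ℕ} {A : Type*} [Ring A] [Algebra ℂ A] (f : Fin n → A)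
    (hf : ∀ i j, f i * f j = f j * f i) (i : Fin n) :
    commEval f hf (MvPolynomial.X i) = f i := by
  simp [commEval]

/-- The inclusion `ℂ[x] → D` of the polynomials in the variables. -/
noncomputable def polyX (n : ℕ) : MvPolynomial (Fin n) ℂ →ₐ[ℂ] WeylAlgebra n := commEval x x_comm

/-- The inclusion `ℂ[∂] → D` of the differential operators with constant coefficients. -/
noncomputable def polyD (n : ℕ) : MvPolynomial (Fin n) ℂ →ₐ[ℂ] WeylAlgebra n := commEval d d_comm

/-- The ring `ℂ[x][ξ]` of polynomials in `ξ` with coefficients in `ℂ[x]`, i.e. the coordinate ring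
of the cotangent bundle of `ℂⁿ`. Degrees are degrees in `ξ`. -/
abbrev Symbols (n : ℕ) : Type := MvPolynomial (Fin n) (MvPolynomial (Fin n) ℂ)

/-- The operator `∑ c_b(x) ∂^b` with total symbol `∑ c_b(x) ξ^b`. -/
noncomputable def normalOrder {n : ℕ} (p : Symbols n) : WeylAlgebra n :=
  ∑ b ∈ p.support, polyX n (p.coeff b) * polyD n (MvPolynomial.monomial b 1)

/-! ## Characteristic varieties and holonomic modules -/

/-- The step `∑_{s ∈ S} F_{m-1}(D) s` of the good filtration of a left `D`-module generated by a
set `S`, where `F_{m-1}(D)` consists of the operators of order less than `m`. -/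
def orderLT {n : ℕ} {M : Type*} [AddCommGroup M] [Module (WeylAlgebra n) M] (S : Set M) (m : ℕ) :
    AddSubgroup M :=
  AddSubgroup.closure {v | ∃ (f g : MvPolynomial (Fin n) ℂ) (s : M),
    g.totalDegree < m ∧ s ∈ S ∧ v = (polyX n f * polyD n g) • s}

/-- The annihilator in `ℂ[x][ξ]` of the graded module attached to the good filtration generated by
`S`. It is a homogeneous ideal, and a homogeneous `p` of degree `k` belongs to it when the operators
with principal symbol `p` map every `F_m(M)` into `F_{m+k-1}(M)`. Its zero set in `ℂ²ⁿ` is the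
characteristic variety of the module. -/
noncomputable def charIdeal {n : ℕ} {M : Type*} [AddCommGroup M] [Module (WeylAlgebra n) M]
    (S : Set M) : Ideal (Symbols n) :=
  Ideal.span {p | ∃ k : ℕ, p.IsHomogeneous k ∧
    ∀ m : ℕ, ∀ v ∈ orderLT (n := n) S (m + 1), normalOrder p • v ∈ orderLT (n := n) S (m + k)}

/-- A finitely generated left module over the Weyl algebra in `n` variables is holonomic if it is
zero or its characteristic variety has dimension `n`. The characteristic variety does not depend on
the finite generating set that is used to compute it. -/
def IsHolonomic (n : ℕ) (M : Type*) [AddCommGroup M] [Module (WeylAlgebra n) M] : Prop :=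
  ∃ S : Finset M, Submodule.span (WeylAlgebra n) (S : Set M) = ⊤ ∧
    (Subsingleton M ∨ ringKrullDim (Symbols n ⧸ charIdeal (n := n) (S : Set M)) = n)

/-- The (holonomic) rank `dim_{ℂ(x)} ℂ(x) ⊗_{ℂ[x]} M` of a left module over the Weyl algebra. -/
noncomputable def holonomicRank (n : ℕ) (M : Type*) [AddCommGroup M] [Module (WeylAlgebra n) M] :
    Cardinal :=
  letI : Module (MvPolynomial (Fin n) ℂ) M := Module.compHom M (polyX n).toRingHom
  Module.rank (FractionRing (MvPolynomial (Fin n) ℂ))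
    (FractionRing (MvPolynomial (Fin n) ℂ) ⊗[MvPolynomial (Fin n) ℂ] M)

end WeylAlgebra

/-! ## The Pearcey system -/

namespace Pearcey

open WeylAlgebra

/-- The Weyl algebra in the variables `(x₁, x₂, η)`, with `x₁ = x 0`, `x₂ = x 1`, `η = x 2`. -/
abbrev D : Type := WeylAlgebra 3

/-- The Weyl algebra in the variables `(x₁, x₂, y)`, with `x₁ = x 0`, `x₂ = x 1`, `y = x 2`. -/
abbrev DB : Type := WeylAlgebra 3

/-- `P₁ = 4 ∂₁ ∂₂ + 2 η x₂ ∂₁ + η² x₁`. -/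
noncomputable def P1 : D := 4 * d 0 * d 1 + 2 * x 2 * x 1 * d 0 + x 2 ^ 2 * x 0

/-- `P₂ = 4 ∂₂² + η x₁ ∂₁ + 2 η x₂ ∂₂ + η`. -/
noncomputable def P2 : D := 4 * d 1 ^ 2 + x 2 * x 0 * d 0 + 2 * x 2 * x 1 * d 1 + x 2

/-- `P₃ = η ∂₂ - ∂₁²`. -/
noncomputable def P3 : D := x 2 * d 1 - d 0 ^ 2

/-- `P₄ = 3 x₁ ∂₁ + 2 x₂ ∂₂ - 4 η ∂_η - 1`. -/
noncomputable def P4 : D := 3 * x 0 * d 0 + 2 * x 1 * d 1 - 4 * x 2 * d 2 - 1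

/-- The left ideal `I` of `D` generated by `P₁, P₂, P₃, P₄`. -/
noncomputable def I : Submodule D D := Submodule.span D {P1, P2, P3, P4}

/-- The Pearcey system with a large parameter, the left `D`-module `M = D / I`. -/
abbrev M : Type := D ⧸ I

/-- The Borel transform `P ↦ P_B`: the algebra homomorphism that fixes `x₁, x₂, ∂₁, ∂₂` and sends
`η` to `∂_y` and `∂_η` to `-y`. -/
noncomputable def borel : D →ₐ[ℂ] DB :=
  WeylAlgebra.lift ![x 0, x 1, d 2] ![d 0, d 1, -x 2]
    (by
      intro i j
      fin_cases i <;> fin_cases j <;> simp [x_comm, d_mul_x])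
    (by
      intro i j
      fin_cases i <;> fin_cases j <;> simp [d_comm, d_mul_x])
    (by
      intro i j
      fin_cases i <;> fin_cases j <;> simp [d_mul_x] <;>
        first | exact d_comm _ _ | exact x_comm _ _)

/-- The left ideal `I_B` of `D_B` generated by `P_{1,B}, P_{2,B}, P_{3,B}, P_{4,B}`. -/
noncomputable def IB : Submodule DB DB :=
  Submodule.span DB {borel P1, borel P2, borel P3, borel P4}

/-- The Borel transformed system, the left `D_B`-module `M_B = D_B / I_B`. -/
abbrev MB : Type := DB ⧸ IB


theorem borel_x0 : borel (x 0) = x 0 := lift_x ..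
theorem borel_x1 : borel (x 1) = x 1 := lift_x ..
theorem borel_x2 : borel (x 2) = d 2 := lift_x ..
theorem borel_d0 : borel (d 0) = d 0 := lift_d ..
theorem borel_d1 : borel (d 1) = d 1 := lift_d ..
theorem borel_d2 : borel (d 2) = -x 2 := lift_d ..

/-- `P_{1,B} = 4 ∂₁ ∂₂ + 2 x₂ ∂₁ ∂_y + x₁ ∂_y²`. -/
theorem borel_P1 : borel P1 = 4 * d 0 * d 1 + 2 * x 1 * d 0 * d 2 + x 0 * d 2 ^ 2 := by
  have h1 : (d 2 : DB) * x 1 = x 1 * d 2 := by simpa using d_mul_x (2 : Fin 3) 1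
  have h0 : (d 2 : DB) * x 0 = x 0 * d 2 := by simpa using d_mul_x (2 : Fin 3) 0
  simp only [P1, map_add, map_mul, map_pow, map_ofNat, borel_x0, borel_x1, borel_x2, borel_d0,
    borel_d1]
  have e1 : (2 : DB) * d 2 * x 1 * d 0 = 2 * x 1 * d 0 * d 2 := by
    rw [mul_assoc 2, h1, mul_assoc, mul_assoc, d_comm 2 0]; noncomm_ring
  have e2 : (d 2 : DB) ^ 2 * x 0 = x 0 * d 2 ^ 2 := by
    rw [pow_two, mul_assoc, h0, ← mul_assoc, h0, mul_assoc]
  rw [e1, e2]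

/-- `P_{2,B} = 4 ∂₂² + x₁ ∂₁ ∂_y + 2 x₂ ∂₂ ∂_y + ∂_y`. -/
theorem borel_P2 :
    borel P2 = 4 * d 1 ^ 2 + x 0 * d 0 * d 2 + 2 * x 1 * d 1 * d 2 + d 2 := by
  have h1 : (d 2 : DB) * x 1 = x 1 * d 2 := by simpa using d_mul_x (2 : Fin 3) 1
  have h0 : (d 2 : DB) * x 0 = x 0 * d 2 := by simpa using d_mul_x (2 : Fin 3) 0
  simp only [P2, map_add, map_mul, map_pow, map_ofNat, borel_x0, borel_x1, borel_x2, borel_d0,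
    borel_d1]
  have e1 : (d 2 : DB) * x 0 * d 0 = x 0 * d 0 * d 2 := by
    rw [h0, mul_assoc, d_comm 2 0, mul_assoc]
  have e2 : (2 : DB) * d 2 * x 1 * d 1 = 2 * x 1 * d 1 * d 2 := by
    rw [mul_assoc 2, h1, mul_assoc, mul_assoc, d_comm 2 1]; noncomm_ring
  rw [e1, e2]

/-- `P_{3,B} = ∂₂ ∂_y - ∂₁²`. -/
theorem borel_P3 : borel P3 = d 1 * d 2 - d 0 ^ 2 := by
  simp only [P3, map_sub, map_mul, map_pow, borel_x2, borel_d0, borel_d1, d_comm 2 1]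

/-- `P_{4,B} = 3 x₁ ∂₁ + 2 x₂ ∂₂ + 4 y ∂_y + 3`. -/
theorem borel_P4 : borel P4 = 3 * x 0 * d 0 + 2 * x 1 * d 1 + 4 * x 2 * d 2 + 3 := by
  have h2 : (d 2 : DB) * x 2 = x 2 * d 2 + 1 := by simpa using d_mul_x (2 : Fin 3) 2
  simp only [P4, map_add, map_sub, map_mul, map_ofNat, map_one, borel_x0, borel_x1, borel_x2,
    borel_d0, borel_d1, borel_d2]
  have e1 : (4 : DB) * d 2 * -x 2 = -(4 * x 2 * d 2) - 4 := by
    rw [mul_neg, mul_assoc, h2, mul_add, mul_one, neg_add, mul_assoc, sub_eq_add_neg]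
  have e2 : (3 : DB) = 4 - 1 := by norm_num
  rw [e1]
  nth_rw 3 [e2]
  abel

end Pearcey

/-! ## The order filtration of the Weyl algebra -/

namespace WeylAlgebra

variable {n : ℕ}

/-! Both modules are cyclic, and both have `1, ∂₁, ∂₂` as a basis after tensoring with the rational
functions. The rank needs two bounds. The upper bound is elimination: every `∂ᵢ` times a basis
operator is, modulo the ideal and after multiplication by a nonzero polynomial, a combination of the
basis (`mem_ratSpan`). The lower bound comes from a representation of the Weyl algebra with a vector
killed by the generators, to which a relation among `1, ∂₁, ∂₂` cannot apply
(`map_apply_eq_zero_of_mem_span`).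

For `M` the representation is the flat connection of rank three read off from `P₁, …, P₄`, and the
vector is `(1, 0, 0)`. For `M_B` it is the function field `ℂ(t, x₁, x₂)`, of degree four over `ℂ(x₁,
x₂, y)` through `y = -(t⁴ + x₂t² + x₁t)`, and the vector is `1/F` with `F = 4t³ + 2x₂t + x₁`, that
is `-∂t/∂y`. This is the formal Borel transform of the Pearcey integral `∫ exp(η(t⁴ + x₂t² + x₁t))
dt`, up to sign. Independence is visible from degrees in `t` modulo 4.

Holonomicity: since the class of `1` is not torsion, the characteristic variety contains the zero
section and has dimension at least 3 (`isHolonomic_quotient`). For the upper bound, the principal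
symbols of the generators suffice. For `M` they force `ξ₁ = ξ₂ = 0` and `ηξ_η = 0`. For `M_B` they
leave the zero section and the conormal variety of the discriminant of `t⁴ + x₂t² + x₁t + y`. In
each case the coordinate ring modulo a prime is integral over a ring generated by three elements
(`ringKrullDim_le_of_isIntegralElem`). -/

theorem polyX_X (i : Fin n) : polyX n (MvPolynomial.X i) = x i := commEval_X ..

theorem polyD_X (i : Fin n) : polyD n (MvPolynomial.X i) = d i := commEval_X ..

theorem d_mul_polyX (i : Fin n) (f : MvPolynomial (Fin n) ℂ) :
    d i * polyX n f = polyX n f * d i + polyX n (MvPolynomial.pderiv i f) := by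
  induction f using MvPolynomial.induction_on with
  | C a =>
    rw [← MvPolynomial.algebraMap_eq, AlgHom.commutes, MvPolynomial.algebraMap_eq,
      MvPolynomial.pderiv_C, map_zero, add_zero, Algebra.commutes]
  | add p q hp hq => simp only [map_add, mul_add, add_mul, hp, hq]; abel
  | mul_X p j hp =>
    rw [map_mul, ← mul_assoc, hp, add_mul, mul_assoc, polyX_X, d_mul_x, Derivation.leibniz,
      MvPolynomial.pderiv_X, map_add, smul_eq_mul, smul_eq_mul, map_mul, map_mul, polyX_X, mul_add]
    have h : x j * polyX n (MvPolynomial.pderiv i p) = polyX n (MvPolynomial.pderiv i p) * x j := by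
      rw [← polyX_X, ← map_mul, ← map_mul, mul_comm]
    rw [h]
    by_cases hij : i = j
    · subst hij; simp; noncomm_ring
    · simp [hij, Ne.symm hij]; noncomm_ring

theorem polyD_mul_x (i : Fin n) (g : MvPolynomial (Fin n) ℂ) :
    polyD n g * x i = x i * polyD n g + polyD n (MvPolynomial.pderiv i g) := by
  induction g using MvPolynomial.induction_on with
  | C a =>
    rw [← MvPolynomial.algebraMap_eq, AlgHom.commutes, MvPolynomial.algebraMap_eq,
      MvPolynomial.pderiv_C, map_zero, add_zero, Algebra.commutes]
  | add p q hp hq => simp only [map_add, mul_add, add_mul, hp, hq]; abel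
  | mul_X p j hp =>
    rw [map_mul, mul_assoc, polyD_X, d_mul_x, mul_add, ← mul_assoc, hp, Derivation.leibniz,
      MvPolynomial.pderiv_X, map_add, smul_eq_mul, smul_eq_mul, map_mul, map_mul, polyD_X, add_mul]
    have h : d j * polyD n (MvPolynomial.pderiv i p) = polyD n (MvPolynomial.pderiv i p) * d j := by
      rw [← polyD_X, ← map_mul, ← map_mul, mul_comm]
    rw [h]
    by_cases hij : i = j
    · subst hij; simp; noncomm_ring
    · simp [Ne.symm hij]; noncomm_ring

/-- The operators of order less than `m`. -/
noncomputable def opLT (n m : ℕ) : AddSubgroup (WeylAlgebra n) :=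
  orderLT (n := n) ({1} : Set (WeylAlgebra n)) m

theorem mul_mem_opLT {m : ℕ} (f : MvPolynomial (Fin n) ℂ) {g : MvPolynomial (Fin n) ℂ}
    (hg : g.totalDegree < m) : polyX n f * polyD n g ∈ opLT n m :=
  AddSubgroup.subset_closure ⟨f, g, 1, hg, rfl, by simp⟩

theorem opLT_induction {m : ℕ} {p : WeylAlgebra n → Prop} (zero : p 0)
    (add : ∀ P Q, p P → p Q → p (P + Q)) (neg : ∀ P, p P → p (-P))
    (mul : ∀ f g : MvPolynomial (Fin n) ℂ, g.totalDegree < m → p (polyX n f * polyD n g))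
    {Q : WeylAlgebra n} (hQ : Q ∈ opLT n m) : p Q := by
  refine AddSubgroup.closure_induction (p := fun Q _ => p Q) ?_ zero
    (fun P Q _ _ => add P Q) (fun P _ => neg P) hQ
  rintro _ ⟨f, g, s, hg, rfl, rfl⟩
  simpa using mul f g hg

theorem opLT_mono {m k : ℕ} (h : m ≤ k) : opLT n m ≤ opLT n k := fun _ hQ =>
  opLT_induction (p := (· ∈ opLT n k)) (zero_mem _) (fun _ _ => add_mem) (fun _ => neg_mem)
    (fun f _ hg => mul_mem_opLT f (hg.trans_le h)) hQ

theorem opLT_zero {Q : WeylAlgebra n} (hQ : Q ∈ opLT n 0) : Q = 0 :=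
  opLT_induction (p := (· = 0)) rfl (fun _ _ h h' => by rw [h, h', add_zero])
    (fun _ h => by rw [h, neg_zero]) (fun _ _ h => absurd h (Nat.not_lt_zero _)) hQ

theorem one_mem_opLT {m : ℕ} (hm : 0 < m) : (1 : WeylAlgebra n) ∈ opLT n m := by
  have h := mul_mem_opLT (n := n) (m := m) 1 (g := 1) (by simpa using hm)
  simpa using h

/-- `P` acts on the order filtration like an operator of order at most `k`: left multiplication by
`P` raises the order by at most `k`, taking the commutator with `P` by at most `k - 1`. -/
structure OrderLE (k : ℕ) (P : WeylAlgebra n) : Prop where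
  mul_mem : ∀ m, ∀ Q ∈ opLT n m, P * Q ∈ opLT n (m + k)
  comm_mem : ∀ m, ∀ Q ∈ opLT n (m + 1), P * Q - Q * P ∈ opLT n (m + k)

namespace OrderLE

variable {k l : ℕ} {P Q : WeylAlgebra n}

theorem mul_right_mem (hP : OrderLE k P) {m : ℕ} (hQ : Q ∈ opLT n m) : Q * P ∈ opLT n (m + k) := by
  -- The commutator bound speaks only of successor indices; at index 0 the filtration step is zero.
  rcases m with _ | m
  · rw [opLT_zero hQ, zero_mul]; exact zero_mem _
  · have h := sub_mem (hP.mul_mem _ _ hQ)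
      (opLT_mono (by omega : m + k ≤ m + 1 + k) (hP.comm_mem _ _ hQ))
    simpa using h

theorem add (hP : OrderLE k P) (hQ : OrderLE k Q) : OrderLE k (P + Q) where
  mul_mem m R hR := by rw [add_mul]; exact add_mem (hP.mul_mem m R hR) (hQ.mul_mem m R hR)
  comm_mem m R hR := by
    rw [show (P + Q) * R - R * (P + Q) = (P * R - R * P) + (Q * R - R * Q) by noncomm_ring]
    exact add_mem (hP.comm_mem m R hR) (hQ.comm_mem m R hR)

theorem neg (hP : OrderLE k P) : OrderLE k (-P) where
  mul_mem m R hR := by rw [neg_mul]; exact neg_mem (hP.mul_mem m R hR)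
  comm_mem m R hR := by
    rw [show -P * R - R * -P = -(P * R - R * P) by noncomm_ring]
    exact neg_mem (hP.comm_mem m R hR)

theorem sub (hP : OrderLE k P) (hQ : OrderLE k Q) : OrderLE k (P - Q) := by
  rw [sub_eq_add_neg]; exact hP.add hQ.neg

theorem mul (hP : OrderLE k P) (hQ : OrderLE l Q) : OrderLE (k + l) (P * Q) where
  mul_mem m R hR := by
    rw [mul_assoc, add_comm k, ← add_assoc]
    exact hP.mul_mem _ _ (hQ.mul_mem m R hR)
  comm_mem m R hR := by
    rw [show P * Q * R - R * (P * Q) = P * (Q * R - R * Q) + (P * R - R * P) * Q by noncomm_ring]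
    refine add_mem ?_ ?_
    · rw [add_comm k, ← add_assoc]
      exact hP.mul_mem _ _ (hQ.comm_mem m R hR)
    · rw [← add_assoc]
      exact hQ.mul_right_mem (hP.comm_mem m R hR)

theorem mono (hP : OrderLE k P) (h : k ≤ l) : OrderLE l P where
  mul_mem m R hR := opLT_mono (by omega) (hP.mul_mem m R hR)
  comm_mem m R hR := opLT_mono (by omega) (hP.comm_mem m R hR)

theorem scalar (c : ℂ) : OrderLE 0 (algebraMap ℂ (WeylAlgebra n) c) where
  mul_mem m R hR := by
    refine opLT_induction (p := fun R => algebraMap ℂ (WeylAlgebra n) c * R ∈ opLT n (m + 0))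
      ?_ ?_ ?_ ?_ hR
    · rw [mul_zero]; exact zero_mem _
    · intro P Q hP hQ; rw [mul_add]; exact add_mem hP hQ
    · intro P hP; rw [mul_neg]; exact neg_mem hP
    · intro f g hg
      rw [← mul_assoc, ← AlgHom.commutes (polyX n), ← map_mul]
      exact mul_mem_opLT _ hg
  comm_mem m R _ := by rw [Algebra.commutes, sub_self]; exact zero_mem _

theorem zero : OrderLE 0 (0 : WeylAlgebra n) := by simpa using scalar (n := n) 0

theorem one : OrderLE 0 (1 : WeylAlgebra n) := by simpa using scalar (n := n) 1

theorem ofNat (r : ℕ) [r.AtLeastTwo] : OrderLE 0 (OfNat.ofNat r : WeylAlgebra n) := by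
  rw [← map_ofNat (algebraMap ℂ (WeylAlgebra n)) r]; exact scalar _

end OrderLE

/-- The zero alternative is needed because `totalDegree 0 = 0`, so the strict bound fails for
constant `g` and `m = 0`. -/
theorem totalDegree_pderiv_lt {m : ℕ} (i : Fin n) {g : MvPolynomial (Fin n) ℂ}
    (hg : g.totalDegree < m + 1) :
    MvPolynomial.pderiv i g = 0 ∨ (MvPolynomial.pderiv i g).totalDegree < m := by
  by_cases h0 : MvPolynomial.pderiv i g = 0
  · exact Or.inl h0
  right
  have key : ∀ b ∈ (MvPolynomial.pderiv i g).support, b.degree < m := by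
    intro b hb
    rw [MvPolynomial.mem_support_iff, MvPolynomial.coeff_pderiv] at hb
    have h : b + Finsupp.single i 1 ∈ g.support := by
      rw [MvPolynomial.mem_support_iff]
      intro h; rw [h] at hb; simp at hb
    have h' := MvPolynomial.le_totalDegree h
    have h'' : (b + Finsupp.single i 1).degree ≤ g.totalDegree := h'
    rw [map_add, Finsupp.degree_single] at h''
    omega
  obtain ⟨b, hb⟩ := MvPolynomial.support_nonempty.mpr h0
  have hm : 0 < m := lt_of_le_of_lt (Nat.zero_le _) (key b hb)
  exact (Finset.sup_lt_iff hm).mpr key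

/-- The commutator with `x i` differentiates the constant coefficient factor `g(∂)`, which costs one
order. For `d i` below, the commutator differentiates the coefficient `f(x)` instead and leaves `g`
alone. -/
theorem orderLE_x (i : Fin n) : OrderLE 0 (x i : WeylAlgebra n) where
  mul_mem m R hR := by
    refine opLT_induction (p := fun R => x i * R ∈ opLT n (m + 0)) ?_ ?_ ?_ ?_ hR
    · rw [mul_zero]; exact zero_mem _
    · intro P Q hP hQ; rw [mul_add]; exact add_mem hP hQ
    · intro P hP; rw [mul_neg]; exact neg_mem hP
    · intro f g hg
      rw [← mul_assoc, ← polyX_X, ← map_mul]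
      exact mul_mem_opLT _ hg
  comm_mem m R hR := by
    refine opLT_induction (p := fun R => x i * R - R * x i ∈ opLT n (m + 0)) ?_ ?_ ?_ ?_ hR
    · rw [mul_zero, zero_mul, sub_zero]; exact zero_mem _
    · intro P Q hP hQ
      rw [show x i * (P + Q) - (P + Q) * x i = (x i * P - P * x i) + (x i * Q - Q * x i) by
        noncomm_ring]
      exact add_mem hP hQ
    · intro P hP
      rw [show x i * -P - -P * x i = -(x i * P - P * x i) by noncomm_ring]
      exact neg_mem hP
    · intro f g hg
      rw [mul_assoc _ _ (x i), polyD_mul_x, ← mul_assoc, mul_add, ← mul_assoc, ← polyX_X, ← map_mul,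
        ← map_mul, mul_comm f, sub_add_cancel_left]
      refine neg_mem ?_
      rcases totalDegree_pderiv_lt i hg with h | h
      · rw [h, map_zero, mul_zero]; exact zero_mem _
      · exact mul_mem_opLT _ h

theorem orderLE_d (i : Fin n) : OrderLE 1 (d i : WeylAlgebra n) where
  mul_mem m R hR := by
    refine opLT_induction (p := fun R => d i * R ∈ opLT n (m + 1)) ?_ ?_ ?_ ?_ hR
    · rw [mul_zero]; exact zero_mem _
    · intro P Q hP hQ; rw [mul_add]; exact add_mem hP hQ
    · intro P hP; rw [mul_neg]; exact neg_mem hP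
    · intro f g hg
      rw [← mul_assoc, d_mul_polyX, add_mul, mul_assoc, ← polyD_X, ← map_mul]
      refine add_mem (mul_mem_opLT _ ?_) (mul_mem_opLT _ (by omega))
      refine lt_of_le_of_lt (MvPolynomial.totalDegree_mul _ _) ?_
      rw [MvPolynomial.totalDegree_X]
      omega
  comm_mem m R hR := by
    refine opLT_induction (p := fun R => d i * R - R * d i ∈ opLT n (m + 1)) ?_ ?_ ?_ ?_ hR
    · rw [mul_zero, zero_mul, sub_zero]; exact zero_mem _
    · intro P Q hP hQ
      rw [show d i * (P + Q) - (P + Q) * d i = (d i * P - P * d i) + (d i * Q - Q * d i) by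
        noncomm_ring]
      exact add_mem hP hQ
    · intro P hP
      rw [show d i * -P - -P * d i = -(d i * P - P * d i) by noncomm_ring]
      exact neg_mem hP
    · intro f g hg
      rw [← mul_assoc, d_mul_polyX, add_mul, mul_assoc, mul_assoc, ← polyD_X, ← map_mul,
        mul_comm (MvPolynomial.X i), map_mul, add_sub_cancel_left]
      exact mul_mem_opLT _ hg

/-! ## Normally ordered operators -/

/-- Summing over any larger index set allows two symbols to be compared over a common one, which
yields additivity. -/
theorem normalOrder_eq_sum {p : Symbols n} {s : Finset (Fin n →₀ ℕ)} (hs : p.support ⊆ s) :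
    normalOrder p = ∑ b ∈ s, polyX n (p.coeff b) * polyD n (MvPolynomial.monomial b 1) := by
  refine Finset.sum_subset hs fun b _ hb => ?_
  rw [MvPolynomial.notMem_support_iff.mp hb, map_zero, zero_mul]

theorem normalOrder_add (p q : Symbols n) :
    normalOrder (p + q) = normalOrder p + normalOrder q := by
  classical
  rw [normalOrder_eq_sum (MvPolynomial.support_add (p := p) (q := q)),
    normalOrder_eq_sum (Finset.subset_union_left (s₁ := p.support) (s₂ := q.support)),
    normalOrder_eq_sum (Finset.subset_union_right (s₁ := p.support) (s₂ := q.support)),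
    ← Finset.sum_add_distrib]
  exact Finset.sum_congr rfl fun b _ => by rw [MvPolynomial.coeff_add, map_add, add_mul]

theorem normalOrder_neg (p : Symbols n) : normalOrder (-p) = -normalOrder p := by
  have h : normalOrder (0 : Symbols n) = 0 := by simp [normalOrder]
  refine eq_neg_of_add_eq_zero_left ?_
  rw [← normalOrder_add, neg_add_cancel, h]

theorem normalOrder_sub (p q : Symbols n) :
    normalOrder (p - q) = normalOrder p - normalOrder q := by
  rw [sub_eq_add_neg, normalOrder_add, normalOrder_neg, sub_eq_add_neg]

theorem normalOrder_monomial (b : Fin n →₀ ℕ) (c : MvPolynomial (Fin n) ℂ) :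
    normalOrder (MvPolynomial.monomial b c) = polyX n c * polyD n (MvPolynomial.monomial b 1) := by
  rw [normalOrder_eq_sum MvPolynomial.support_monomial_subset]
  simp

theorem normalOrder_C (c : MvPolynomial (Fin n) ℂ) :
    normalOrder (MvPolynomial.C c) = polyX n c := by
  rw [MvPolynomial.C_apply, normalOrder_monomial]
  simp

theorem normalOrder_C_mul_X (c : MvPolynomial (Fin n) ℂ) (i : Fin n) :
    normalOrder (MvPolynomial.C c * MvPolynomial.X i) = polyX n c * d i := by
  rw [MvPolynomial.C_mul_X_eq_monomial, normalOrder_monomial, ← polyD_X, MvPolynomial.X]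

theorem normalOrder_C_mul_X_mul_X (c : MvPolynomial (Fin n) ℂ) (i j : Fin n) :
    normalOrder (MvPolynomial.C c * (MvPolynomial.X i * MvPolynomial.X j)) =
      polyX n c * (d i * d j) := by
  rw [MvPolynomial.X, MvPolynomial.X, MvPolynomial.monomial_mul, MvPolynomial.C_mul_monomial,
    normalOrder_monomial, ← polyD_X, ← polyD_X, ← map_mul, MvPolynomial.X, MvPolynomial.X,
    MvPolynomial.monomial_mul]
  simp

/-! ## Characteristic ideals of cyclic modules -/

section Cyclic

variable (J : Submodule (WeylAlgebra n) (WeylAlgebra n))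

theorem mem_orderLT_mk {m : ℕ} {v : WeylAlgebra n ⧸ J} :
    v ∈ orderLT (n := n) ({J.mkQ 1} : Set (WeylAlgebra n ⧸ J)) m ↔ ∃ Q ∈ opLT n m, J.mkQ Q = v := by
  have h : orderLT (n := n) ({J.mkQ 1} : Set (WeylAlgebra n ⧸ J)) m =
      (opLT n m).map J.mkQ.toAddMonoidHom := by
    rw [opLT, orderLT, orderLT, AddMonoidHom.map_closure]
    congr 1
    ext v
    constructor
    · rintro ⟨f, g, s, hg, hs, rfl⟩
      rw [Set.mem_singleton_iff] at hs
      subst hs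
      refine ⟨polyX n f * polyD n g, ⟨f, g, 1, hg, rfl, by simp⟩, ?_⟩
      change J.mkQ _ = _
      rw [← map_smul, smul_eq_mul, mul_one]
    · rintro ⟨_, ⟨f, g, s, hg, rfl, rfl⟩, rfl⟩
      exact ⟨f, g, J.mkQ 1, hg, rfl, (map_smul J.mkQ _ _)⟩
  rw [h, AddSubgroup.mem_map]
  rfl

variable {J}

/-- Principal symbols of elements of a left ideal belong to the characteristic ideal. -/
theorem mem_charIdeal {p : Symbols n} {k : ℕ} (hp : p.IsHomogeneous (k + 1)) {P : WeylAlgebra n}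
    (hPJ : P ∈ J) (ho : OrderLE (k + 1) (normalOrder p)) (hR : OrderLE k (normalOrder p - P)) :
    p ∈ charIdeal (n := n) ({J.mkQ 1} : Set (WeylAlgebra n ⧸ J)) := by
  refine Ideal.subset_span ⟨k + 1, hp, fun m v hv => ?_⟩
  obtain ⟨Q, hQ, rfl⟩ := (mem_orderLT_mk J).mp hv
  -- Modulo `J` the term `Q * P` vanishes, so `p̂Q ≡ [p̂, Q] + Q(p̂ - P)` for `p̂ = normalOrder p`.
  -- Both summands have lost one order.
  refine (mem_orderLT_mk J).mpr ⟨(normalOrder p * Q - Q * normalOrder p) + Q * (normalOrder p - P),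
    add_mem (ho.comm_mem m Q hQ) ?_, ?_⟩
  · have h := hR.mul_right_mem hQ
    rwa [add_right_comm] at h
  · rw [← map_smul, smul_eq_mul, ← sub_eq_zero, ← map_sub]
    refine (Submodule.Quotient.mk_eq_zero J).mpr ?_
    rw [show normalOrder p * Q - Q * normalOrder p + Q * (normalOrder p - P) - normalOrder p * Q =
      (-Q) • P by rw [smul_eq_mul]; noncomm_ring]
    exact J.smul_mem _ hPJ

/-- The characteristic variety of `D / J` contains the zero section if the class of `1` is not
annihilated by a nonzero polynomial. -/
theorem charIdeal_le_ker_constantCoeff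
    (hJ : ∀ c : MvPolynomial (Fin n) ℂ, polyX n c ∈ J → c = 0) :
    charIdeal (n := n) ({J.mkQ 1} : Set (WeylAlgebra n ⧸ J)) ≤
      RingHom.ker (MvPolynomial.constantCoeff : Symbols n →+* _) := by
  refine Ideal.span_le.mpr ?_
  rintro p ⟨k, hp, h⟩
  change MvPolynomial.constantCoeff p = 0
  rcases k with _ | k
  · have hc : p = MvPolynomial.C (MvPolynomial.constantCoeff p) := by
      rw [MvPolynomial.constantCoeff_eq]
      exact MvPolynomial.totalDegree_eq_zero_iff_eq_C.mp (by
        by_cases h0 : p = 0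
        · simp [h0]
        · exact hp.totalDegree h0)
    -- A symbol of degree 0 is a polynomial `c(x)`. The case `m = 0` sends the class of `1` into the
    -- zeroth step, which is zero, so `c ∈ J`.
    have h1 := h 0 (J.mkQ 1) ((mem_orderLT_mk J).mpr ⟨1, one_mem_opLT Nat.one_pos, rfl⟩)
    obtain ⟨Q, hQ, hQ'⟩ := (mem_orderLT_mk J).mp h1
    rw [opLT_zero hQ, map_zero, hc, normalOrder_C, ← map_smul, smul_eq_mul, mul_one] at hQ'
    exact hJ _ ((Submodule.Quotient.mk_eq_zero J).mp hQ'.symm)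
  · rw [MvPolynomial.constantCoeff_eq]
    exact hp.coeff_eq_zero (by simp)

/-- Restriction to the zero section is a surjection onto `ℂ[x]`, whose Krull dimension is `n`. -/
theorem le_ringKrullDim_charIdeal
    (hJ : ∀ c : MvPolynomial (Fin n) ℂ, polyX n c ∈ J → c = 0) :
    n ≤ ringKrullDim (Symbols n ⧸ charIdeal (n := n) ({J.mkQ 1} : Set (WeylAlgebra n ⧸ J))) := by
  let f : (Symbols n ⧸ charIdeal (n := n) ({J.mkQ 1} : Set (WeylAlgebra n ⧸ J))) →+*
      MvPolynomial (Fin n) ℂ := Ideal.Quotient.lift _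
    (MvPolynomial.constantCoeff : Symbols n →+* MvPolynomial (Fin n) ℂ)
    fun p hp => charIdeal_le_ker_constantCoeff hJ hp
  have hf : Function.Surjective f := fun c =>
    ⟨Ideal.Quotient.mk _ (MvPolynomial.C c), MvPolynomial.constantCoeff_C _ c⟩
  have h := ringKrullDim_le_of_surjective
    (R := Symbols n ⧸ charIdeal (n := n) ({J.mkQ 1} : Set (WeylAlgebra n ⧸ J)))
    (S := MvPolynomial (Fin n) ℂ) f hf
  rw [MvPolynomial.ringKrullDim_of_isNoetherianRing, ringKrullDim_eq_zero_of_field] at h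
  simpa using h

/-- With the zero section inside the characteristic variety, only the upper bound of the dimension
remains to be supplied. -/
theorem isHolonomic_quotient
    (hJ : ∀ c : MvPolynomial (Fin n) ℂ, polyX n c ∈ J → c = 0)
    (h : ringKrullDim (Symbols n ⧸ charIdeal (n := n) ({J.mkQ 1} : Set (WeylAlgebra n ⧸ J))) ≤ n) :
    IsHolonomic n (WeylAlgebra n ⧸ J) := by
  refine ⟨{J.mkQ 1}, ?_, Or.inr ?_⟩
  · rw [Finset.coe_singleton, ← Set.image_singleton, ← Submodule.map_span,
      show Submodule.span (WeylAlgebra n) {(1 : WeylAlgebra n)} = ⊤ from Ideal.span_singleton_one,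
      Submodule.map_top, Submodule.range_mkQ]
  · rw [Finset.coe_singleton]
    exact le_antisymm h (le_ringKrullDim_charIdeal hJ)

end Cyclic

end WeylAlgebra

/-! ## Generic bases and holonomic rank -/

namespace WeylAlgebra

variable {n : ℕ}

theorem left_induction {S : Set (WeylAlgebra n)} (one : 1 ∈ S)
    (add : ∀ P ∈ S, ∀ Q ∈ S, P + Q ∈ S) (scalar : ∀ (c : ℂ), ∀ P ∈ S, algebraMap ℂ _ c * P ∈ S)
    (hx : ∀ i, ∀ P ∈ S, x i * P ∈ S) (hd : ∀ i, ∀ P ∈ S, d i * P ∈ S) (P : WeylAlgebra n) :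
    P ∈ S := by
  -- Strengthened so that an induction over words in the generators can compose left
  -- multiplications.
  suffices h : ∀ Q ∈ S, P * Q ∈ S by simpa using h 1 one
  obtain ⟨P, rfl⟩ : ∃ P', mk n P' = P := RingQuot.mkAlgHom_surjective ℂ (WeylRel n) P
  induction P using FreeAlgebra.induction with
  | grade0 c => intro Q hQ; rw [AlgHom.commutes]; exact scalar c Q hQ
  | grade1 s =>
    intro Q hQ
    rcases s with i | i
    · exact hx i Q hQ
    · exact hd i Q hQ
  | mul a b ha hb => intro Q hQ; rw [map_mul, mul_assoc]; exact ha _ (hb _ hQ)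
  | add a b ha hb => intro Q hQ; rw [map_add, add_mul]; exact add _ (ha _ hQ) _ (hb _ hQ)

/-- The Weyl algebra as a left module over the polynomials in the variables. -/
@[reducible]
noncomputable def polyModule (n : ℕ) : Module (MvPolynomial (Fin n) ℂ) (WeylAlgebra n) :=
  Module.compHom (WeylAlgebra n) (polyX n).toRingHom

attribute [local instance] polyModule

theorem poly_smul_def (p : MvPolynomial (Fin n) ℂ) (Q : WeylAlgebra n) : p • Q = polyX n p * Q :=
  rfl

theorem d_mul_smul (i : Fin n) (p : MvPolynomial (Fin n) ℂ) (Q : WeylAlgebra n) :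
    d i * (p • Q) = p • (d i * Q) + MvPolynomial.pderiv i p • Q := by
  simp only [poly_smul_def]
  rw [← mul_assoc, d_mul_polyX, add_mul, mul_assoc]

theorem poly_smul_mem (J : Submodule (WeylAlgebra n) (WeylAlgebra n)) (p : MvPolynomial (Fin n) ℂ)
    {Q : WeylAlgebra n} (hQ : Q ∈ J) : p • Q ∈ J := J.smul_mem (polyX n p) hQ

/-- The operators that become, modulo the left ideal `J`, combinations of the `E j` with rational
functions as coefficients. -/
noncomputable def ratSpan (J : Submodule (WeylAlgebra n) (WeylAlgebra n)) {r : ℕ}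
    (E : Fin r → WeylAlgebra n) : Submodule (MvPolynomial (Fin n) ℂ) (WeylAlgebra n) where
  carrier := {Q | ∃ q : MvPolynomial (Fin n) ℂ, q ≠ 0 ∧ ∃ p : Fin r → MvPolynomial (Fin n) ℂ,
    q • Q - ∑ j, p j • E j ∈ J}
  zero_mem' := ⟨1, one_ne_zero, 0, by simp⟩
  add_mem' := by
    rintro P Q ⟨a, ha, p, hp⟩ ⟨b, hb, q, hq⟩
    refine ⟨a * b, mul_ne_zero ha hb, fun j => b * p j + a * q j, ?_⟩
    have h := J.add_mem (poly_smul_mem J b hp) (poly_smul_mem J a hq)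
    convert h using 1
    simp only [smul_sub, Finset.smul_sum, add_smul, Finset.sum_add_distrib, smul_smul, smul_add,
      mul_comm a b]
    abel
  smul_mem' := by
    rintro c P ⟨a, ha, p, hp⟩
    refine ⟨a, ha, fun j => c * p j, ?_⟩
    have h := poly_smul_mem J c hp
    simpa only [smul_sub, Finset.smul_sum, smul_smul, mul_comm c a] using h

section RatSpan

variable {J : Submodule (WeylAlgebra n) (WeylAlgebra n)} {r : ℕ} {E : Fin r → WeylAlgebra n}

theorem mem_ratSpan_of_mem {Q : WeylAlgebra n} (hQ : Q ∈ J) : Q ∈ ratSpan J E :=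
  ⟨1, one_ne_zero, 0, by simpa using hQ⟩

theorem basis_mem_ratSpan (j : Fin r) : E j ∈ ratSpan J E :=
  ⟨1, one_ne_zero, Pi.single j 1, by
    rw [Finset.sum_eq_single j]
    · simp
    · intro i _ hi; simp [hi]
    · simp⟩

theorem mem_ratSpan_of_smul_mem {a : MvPolynomial (Fin n) ℂ} (ha : a ≠ 0) {Q : WeylAlgebra n}
    (h : a • Q ∈ ratSpan J E) : Q ∈ ratSpan J E := by
  obtain ⟨q, hq, p, hp⟩ := h
  exact ⟨q * a, mul_ne_zero hq ha, p, by rwa [mul_smul]⟩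

/-- The quotient rule with denominators cleared: `q • (∂ᵢQ) = ∂ᵢ(q • Q) - (∂ᵢq) • Q`, where the
right side is already in the span. -/
theorem d_mul_mem_ratSpan (hE : ∀ i j, d i * E j ∈ ratSpan J E) (i : Fin n) {Q : WeylAlgebra n}
    (hQ : Q ∈ ratSpan J E) : d i * Q ∈ ratSpan J E := by
  obtain ⟨q, hq, p, hp⟩ := id hQ
  have h : d i * (q • Q - ∑ j, p j • E j) ∈ ratSpan J E := mem_ratSpan_of_mem (J.smul_mem (d i) hp)
  have h1 : d i * ∑ j, p j • E j ∈ ratSpan J E := by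
    rw [Finset.mul_sum]
    refine Submodule.sum_mem _ fun j _ => ?_
    rw [d_mul_smul]
    exact add_mem (Submodule.smul_mem _ _ (hE i j)) (Submodule.smul_mem _ _ (basis_mem_ratSpan j))
  refine mem_ratSpan_of_smul_mem hq ?_
  have h2 := sub_mem (add_mem h h1)
    (Submodule.smul_mem (ratSpan J E) (MvPolynomial.pderiv i q) hQ)
  rwa [mul_sub, d_mul_smul, sub_add_cancel, add_sub_cancel_right] at h2

/-- Reducing the finitely many products `∂ᵢ E j` makes the span stable under left multiplication by
the whole Weyl algebra; it contains `1`. -/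
theorem mem_ratSpan (h1 : 1 ∈ ratSpan J E) (hE : ∀ i j, d i * E j ∈ ratSpan J E)
    (Q : WeylAlgebra n) : Q ∈ ratSpan J E :=
  left_induction (S := ratSpan J E) h1 (fun _ hP _ hQ => add_mem hP hQ)
    (fun c P hP => by
      rw [← AlgHom.commutes (polyX n)]
      exact Submodule.smul_mem _ _ hP)
    (fun i P hP => by
      rw [← polyX_X]
      exact Submodule.smul_mem _ _ hP)
    (fun i _ hP => d_mul_mem_ratSpan hE i hP) Q

/-- The holonomic rank of `D / J` is `r` if `E 0, …, E (r-1)` is a generic basis. -/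
theorem holonomicRank_eq (hE : ∀ Q, Q ∈ ratSpan J E)
    (hind : ∀ p : Fin r → MvPolynomial (Fin n) ℂ, ∑ j, p j • E j ∈ J → p = 0) :
    holonomicRank n (WeylAlgebra n ⧸ J) = r := by
  let _ : Module (MvPolynomial (Fin n) ℂ) (WeylAlgebra n ⧸ J) :=
    Module.compHom (WeylAlgebra n ⧸ J) (polyX n).toRingHom
  change Module.rank (FractionRing (MvPolynomial (Fin n) ℂ))
    (FractionRing (MvPolynomial (Fin n) ℂ) ⊗[MvPolynomial (Fin n) ℂ] (WeylAlgebra n ⧸ J)) = r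
  -- The dimension over the fraction field equals the rank over the domain `ℂ[x]`, so the remaining
  -- argument takes place in `D / J`.
  rw [IsBaseChange.rank_eq (TensorProduct.isBaseChange (MvPolynomial (Fin n) ℂ)
    (WeylAlgebra n ⧸ J) (FractionRing (MvPolynomial (Fin n) ℂ)))]
  let π : WeylAlgebra n →ₗ[MvPolynomial (Fin n) ℂ] WeylAlgebra n ⧸ J :=
    { toFun := J.mkQ, map_add' := map_add _, map_smul' := fun _ _ => rfl }
  have hπ : ∀ Q, π Q = 0 ↔ Q ∈ J := fun Q => Submodule.Quotient.mk_eq_zero J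
  have hli : LinearIndependent (MvPolynomial (Fin n) ℂ) fun j => π (E j) := by
    rw [Fintype.linearIndependent_iff]
    intro p hp
    simp only [← map_smul, ← map_sum] at hp
    exact fun j => congrFun (hind p ((hπ _).mp hp)) j
  refine le_antisymm ?_ (by simpa using hli.cardinal_le_rank)
  let N := Submodule.span (MvPolynomial (Fin n) ℂ) (Set.range fun j => π (E j))
  -- By `hE` every element is torsion modulo the span of the `E j`, so by additivity of the rank
  -- this span carries all of it.
  have h0 : Module.rank (MvPolynomial (Fin n) ℂ) ((WeylAlgebra n ⧸ J) ⧸ N) = 0 := by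
    rw [rank_eq_zero_iff]
    intro v
    obtain ⟨v, rfl⟩ := N.mkQ_surjective v
    obtain ⟨Q, rfl⟩ := J.mkQ_surjective v
    obtain ⟨q, hq, p, hp⟩ := hE Q
    refine ⟨q, hq, ?_⟩
    rw [← map_smul]
    refine (Submodule.Quotient.mk_eq_zero N).mpr ?_
    change q • π Q ∈ N
    rw [← hπ, map_sub, sub_eq_zero, map_smul, map_sum] at hp
    rw [hp]
    refine Submodule.sum_mem _ fun j _ => ?_
    rw [map_smul]
    exact Submodule.smul_mem _ _ (Submodule.subset_span ⟨j, rfl⟩)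
  rw [← rank_quotient_add_rank_of_isDomain N, h0, zero_add]
  refine (rank_span_le _).trans ?_
  refine Cardinal.mk_range_le.trans ?_
  simp

end RatSpan

/-! ## Elements annihilated by a left ideal -/

/-- The annihilator of a vector is a left ideal, so checking generators is enough. -/
theorem map_apply_eq_zero_of_mem_span {N : Type*} [AddCommGroup N] [Module ℂ N]
    (ρ : WeylAlgebra n →ₐ[ℂ] Module.End ℂ N) (v : N) {S : Set (WeylAlgebra n)}
    (hS : ∀ P ∈ S, ρ P v = 0) {P : WeylAlgebra n} (hP : P ∈ Submodule.span (WeylAlgebra n) S) :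
    ρ P v = 0 := by
  induction hP using Submodule.span_induction with
  | mem P hP => exact hS P hP
  | zero => simp
  | add P Q _ _ hP hQ => simp [hP, hQ]
  | smul a P _ hP => rw [smul_eq_mul, map_mul, Module.End.mul_apply, hP, map_zero]

end WeylAlgebra

/-! ## Krull dimensions -/

section KrullDim

variable {R : Type*} [CommRing R]

/-- A chain of primes of `R ⧸ J` starting at `p` pulls back to a chain above the preimage of `p`.
The reduction makes the quotient a domain, where equations between symbols can be split into cases.
-/
theorem ringKrullDim_quotient_le_of_forall_isPrime {J : Ideal R} {d : WithBot ℕ∞}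
    (h : ∀ P : Ideal R, P.IsPrime → J ≤ P → ringKrullDim (R ⧸ P) ≤ d) :
    ringKrullDim (R ⧸ J) ≤ d := by
  rw [ringKrullDim, Order.krullDim_eq_iSup_coheight]
  refine iSup_le fun p => ?_
  rw [Order.coheight_eq_krullDim_Ici]
  let P := p.asIdeal.comap (Ideal.Quotient.mk J)
  refine le_trans ?_ (h P inferInstance fun a ha => ?_)
  · rw [ringKrullDim_quotient]
    refine Order.krullDim_le_of_strictMono (fun q => ⟨PrimeSpectrum.comap (Ideal.Quotient.mk J) q.1,
      fun a ha => ?_⟩) ?_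
    · exact (PrimeSpectrum.asIdeal_le_asIdeal _ _).mpr q.2 ha
    · intro q q' hq
      have hq' : q.1.asIdeal < q'.1.asIdeal := hq
      change q.1.asIdeal.comap (Ideal.Quotient.mk J) < q'.1.asIdeal.comap (Ideal.Quotient.mk J)
      refine lt_of_le_of_ne (Ideal.comap_mono hq'.le) fun he => hq'.ne ?_
      exact Ideal.comap_injective_of_surjective _ Ideal.Quotient.mk_surjective he
  · have h0 : Ideal.Quotient.mk J a = 0 := Ideal.Quotient.eq_zero_iff_mem.mpr ha
    change Ideal.Quotient.mk J a ∈ p.asIdeal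
    rw [h0]
    exact zero_mem _

/-- Incomparability: contraction of primes along an integral extension is strictly monotone. -/
theorem ringKrullDim_le_of_isIntegral {S : Type*} [CommRing S] [Algebra R S]
    [Algebra.IsIntegral R S] : ringKrullDim S ≤ ringKrullDim R := by
  refine Order.krullDim_le_of_strictMono (PrimeSpectrum.comap (algebraMap R S)) fun p q hpq => ?_
  have hpq' : p.asIdeal < q.asIdeal := hpq
  exact Ideal.IsIntegral.comap_lt_comap hpq'

theorem ringKrullDim_le_of_isIntegral_aeval {S : Type*} [CommRing S] [Algebra ℂ S] {n : ℕ}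
    (a : Fin n → S)
    (h : (MvPolynomial.aeval a : MvPolynomial (Fin n) ℂ →ₐ[ℂ] S).toRingHom.IsIntegral) :
    ringKrullDim S ≤ n := by
  let _ := (MvPolynomial.aeval a : MvPolynomial (Fin n) ℂ →ₐ[ℂ] S).toRingHom.toAlgebra
  have _ : Algebra.IsIntegral (MvPolynomial (Fin n) ℂ) S := ⟨h⟩
  refine (ringKrullDim_le_of_isIntegral (R := MvPolynomial (Fin n) ℂ) (S := S)).trans ?_
  rw [MvPolynomial.ringKrullDim_of_isNoetherianRing, ringKrullDim_eq_zero_of_field]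
  simp

/-- A `ℂ`-algebra generated by elements that are integral over the subalgebra generated by `n`
elements has Krull dimension at most `n`. -/
theorem ringKrullDim_le_of_isIntegralElem {S : Type*} [CommRing S] [Algebra ℂ S] {m n : ℕ}
    (φ : WeylAlgebra.Symbols m →ₐ[ℂ] S) (hφ : Function.Surjective φ) (a : Fin n → S)
    (hx : ∀ i, (MvPolynomial.aeval a : MvPolynomial (Fin n) ℂ →ₐ[ℂ] S).toRingHom.IsIntegralElem
      (φ (MvPolynomial.C (MvPolynomial.X i))))
    (hξ : ∀ i, (MvPolynomial.aeval a : MvPolynomial (Fin n) ℂ →ₐ[ℂ] S).toRingHom.IsIntegralElem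
      (φ (MvPolynomial.X i))) :
    ringKrullDim S ≤ n := by
  refine ringKrullDim_le_of_isIntegral_aeval a fun s => ?_
  obtain ⟨p, rfl⟩ := hφ s
  induction p using MvPolynomial.induction_on with
  | C c =>
    induction c using MvPolynomial.induction_on with
    | C z =>
      have h : φ (MvPolynomial.C (MvPolynomial.C z)) =
          (MvPolynomial.aeval a : MvPolynomial (Fin n) ℂ →ₐ[ℂ] S).toRingHom
            (MvPolynomial.C z) := by
        refine (φ.commutes z).trans ?_
        exact ((MvPolynomial.aeval a : MvPolynomial (Fin n) ℂ →ₐ[ℂ] S).commutes z).symm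
      rw [h]
      exact RingHom.isIntegralElem_map _
    | add p q hp hq => rw [map_add, map_add]; exact hp.add _ hq
    | mul_X p i hp => rw [map_mul, map_mul]; exact hp.mul _ (hx i)
  | add p q hp hq => rw [map_add]; exact hp.add _ hq
  | mul_X p i hp => rw [map_mul]; exact hp.mul _ (hξ i)

theorem isIntegralElem_aeval {S : Type*} [CommRing S] [Algebra ℂ S] {n : ℕ} (a : Fin n → S) {s : S}
    (hs : s = 0 ∨ ∃ i, a i = s) :
    (MvPolynomial.aeval a : MvPolynomial (Fin n) ℂ →ₐ[ℂ] S).toRingHom.IsIntegralElem s := by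
  rcases hs with rfl | ⟨i, rfl⟩
  · exact RingHom.isIntegralElem_zero _
  · have h := RingHom.isIntegralElem_map
      (MvPolynomial.aeval a : MvPolynomial (Fin n) ℂ →ₐ[ℂ] S).toRingHom (x := MvPolynomial.X i)
    simpa using h

/-- The same monic polynomial works. This permits proving integrality in a fraction field, where
divisions are available. -/
theorem RingHom.IsIntegralElem.of_comp_injective {S T : Type*} [CommRing S] [CommRing T]
    {f : R →+* S} {ι : S →+* T} (hι : Function.Injective ι) {s : S}
    (h : (ι.comp f).IsIntegralElem (ι s)) : f.IsIntegralElem s := by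
  obtain ⟨p, hp, h0⟩ := h
  refine ⟨p, hp, hι ?_⟩
  rw [Polynomial.hom_eval₂, h0, map_zero]

end KrullDim

/-! ## Derivations of fields of rational functions -/

section Derivation

variable {R S : Type*} [CommRing R] [CommRing S] [Algebra R S] (T : Type*) [CommRing T]
  [Algebra R T] [Algebra S T] [IsScalarTower R S T]

/-- The extension of a derivation to a formally étale algebra. -/
noncomputable def Derivation.extendOfFormallyEtale [Algebra.FormallyEtale S T]
    (δ : Derivation R S S) : Derivation R T T :=
  -- Formal étaleness identifies `T ⊗ Ω[S⁄R]` with `Ω[T⁄R]`, so the linear map attached to `δ`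
  -- extends uniquely to differentials of `T`.
  ((LinearMap.liftBaseChange T
    (Algebra.linearMap S T ∘ₗ δ.liftKaehlerDifferential)) ∘ₗ
      (KaehlerDifferential.tensorKaehlerEquivOfFormallyEtale R S T).symm.toLinearMap).compDer
    (KaehlerDifferential.D R T)

theorem Derivation.extendOfFormallyEtale_algebraMap [Algebra.FormallyEtale S T]
    (δ : Derivation R S S) (s : S) :
    δ.extendOfFormallyEtale T (algebraMap S T s) = algebraMap S T (δ s) := by
  change LinearMap.liftBaseChange T _
    ((KaehlerDifferential.tensorKaehlerEquivOfFormallyEtale R S T).symm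
      (KaehlerDifferential.D R T (algebraMap S T s))) = _
  rw [KaehlerDifferential.tensorKaehlerEquivOfFormallyEtale_symm_D_algebraMap,
    LinearMap.liftBaseChange_tmul, one_smul, LinearMap.comp_apply,
    Derivation.liftKaehlerDifferential_comp_D, Algebra.linearMap_apply]

end Derivation

/-- The field of rational functions in three variables. -/
abbrev RatFun3 : Type := FractionRing (MvPolynomial (Fin 3) ℂ)

namespace RatFun3

noncomputable instance : Algebra.FormallyEtale (MvPolynomial (Fin 3) ℂ) RatFun3 :=
  Algebra.FormallyEtale.of_isLocalization (nonZeroDivisors (MvPolynomial (Fin 3) ℂ))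

/-- The inclusion of the polynomials. -/
noncomputable def ofPoly : MvPolynomial (Fin 3) ℂ →ₐ[ℂ] RatFun3 :=
  IsScalarTower.toAlgHom ℂ (MvPolynomial (Fin 3) ℂ) RatFun3

theorem ofPoly_injective : Function.Injective ofPoly :=
  IsFractionRing.injective (MvPolynomial (Fin 3) ℂ) RatFun3

/-- The coordinate functions. -/
noncomputable def var (i : Fin 3) : RatFun3 := ofPoly (MvPolynomial.X i)

/-- The partial derivatives of rational functions. -/
noncomputable def partialD (i : Fin 3) : Derivation ℂ RatFun3 RatFun3 :=
  (MvPolynomial.pderiv i).extendOfFormallyEtale RatFun3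

theorem partialD_ofPoly (i : Fin 3) (p : MvPolynomial (Fin 3) ℂ) :
    partialD i (ofPoly p) = ofPoly (MvPolynomial.pderiv i p) :=
  Derivation.extendOfFormallyEtale_algebraMap _ _ _

theorem partialD_var (i j : Fin 3) : partialD i (var j) = if i = j then 1 else 0 := by
  rw [var, partialD_ofPoly, MvPolynomial.pderiv_X, Pi.single_apply, apply_ite ofPoly, map_one,
    map_zero]
  simp only [eq_comm]

/-- Agreement on coordinates passes to polynomials by Leibniz and to a fraction `u = a/b` by
differentiating `a = u * b`. -/
theorem derivation_ext {δ ε : Derivation ℂ RatFun3 RatFun3} (h : ∀ i, δ (var i) = ε (var i)) :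
    δ = ε := by
  have h1 : ∀ p, δ (ofPoly p) = ε (ofPoly p) := by
    intro p
    induction p using MvPolynomial.induction_on with
    | C a =>
      rw [← MvPolynomial.algebraMap_eq, AlgHom.commutes, Derivation.map_algebraMap,
        Derivation.map_algebraMap]
    | add p q hp hq => rw [map_add, map_add, map_add, hp, hq]
    | mul_X p i hp =>
      rw [map_mul, Derivation.leibniz, Derivation.leibniz, hp]
      congr 2
      exact h i
  ext u
  obtain ⟨a, b, hb, rfl⟩ := IsFractionRing.div_surjective (A := MvPolynomial (Fin 3) ℂ) u
  have hb0 : algebraMap (MvPolynomial (Fin 3) ℂ) RatFun3 b ≠ 0 :=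
    IsFractionRing.to_map_ne_zero_of_mem_nonZeroDivisors hb
  have hδ := h1 a
  have hb' := h1 b
  have ha : ofPoly a = (algebraMap _ RatFun3 a / algebraMap _ RatFun3 b) * ofPoly b :=
    (div_mul_cancel₀ _ hb0).symm
  rw [ha, Derivation.leibniz, Derivation.leibniz, hb', add_right_inj, smul_eq_mul,
    smul_eq_mul] at hδ
  exact mul_left_cancel₀ hb0 hδ

/-- The commutator is again a derivation, hence determined by its values on coordinates. -/
theorem derivation_commute {δ ε : Derivation ℂ RatFun3 RatFun3}
    (h : ∀ i, δ (ε (var i)) = ε (δ (var i))) (u : RatFun3) : δ (ε u) = ε (δ u) := by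
  have h0 : ⁅δ, ε⁆ = 0 := derivation_ext fun i => by
    rw [Derivation.commutator_apply, h, sub_self, Derivation.zero_apply]
  have h1 := Derivation.congr_fun h0 u
  rwa [Derivation.commutator_apply, Derivation.zero_apply, sub_eq_zero] at h1

theorem partialD_comm (i j : Fin 3) (u : RatFun3) :
    partialD i (partialD j u) = partialD j (partialD i u) :=
  derivation_commute (fun k => by
    rw [partialD_var, partialD_var]
    split_ifs <;> simp) u

end RatFun3

/-! ### Elimination modulo the rational span -/

namespace WeylAlgebra

variable {n : ℕ}

attribute [local instance] polyModule

/-- The quotient by the rational span is torsion free, so reducing operators to the basis becomes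
solving a homogeneous linear system with polynomial coefficients. -/
theorem mkQ_ratSpan_eq_zero {J : Submodule (WeylAlgebra n) (WeylAlgebra n)} {r : ℕ}
    {E : Fin r → WeylAlgebra n} {a : MvPolynomial (Fin n) ℂ} (ha : a ≠ 0) {Q : WeylAlgebra n}
    (h : a • (ratSpan J E).mkQ Q = 0) : (ratSpan J E).mkQ Q = 0 := by
  rw [← map_smul] at h
  exact (Submodule.Quotient.mk_eq_zero _).mpr
    (mem_ratSpan_of_smul_mem ha ((Submodule.Quotient.mk_eq_zero _).mp h))

theorem mkQ_ratSpan_mem {J : Submodule (WeylAlgebra n) (WeylAlgebra n)} {r : ℕ}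
    {E : Fin r → WeylAlgebra n} {Q : WeylAlgebra n} (h : Q ∈ J) : (ratSpan J E).mkQ Q = 0 :=
  (Submodule.Quotient.mk_eq_zero _).mpr (mem_ratSpan_of_mem h)

theorem mkQ_ratSpan_basis {J : Submodule (WeylAlgebra n) (WeylAlgebra n)} {r : ℕ}
    {E : Fin r → WeylAlgebra n} (j : Fin r) : (ratSpan J E).mkQ (E j) = 0 :=
  (Submodule.Quotient.mk_eq_zero _).mpr (basis_mem_ratSpan j)

/-- Independence of a basis containing `1` supplies the torsion condition required for holonomicity.
-/
theorem eq_zero_of_polyX_mem {J : Submodule (WeylAlgebra n) (WeylAlgebra n)} {r : ℕ}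
    {E : Fin r → WeylAlgebra n}
    (hind : ∀ p : Fin r → MvPolynomial (Fin n) ℂ, ∑ j, p j • E j ∈ J → p = 0) {j : Fin r}
    (hj : E j = 1) (c : MvPolynomial (Fin n) ℂ) (hc : polyX n c ∈ J) : c = 0 := by
  have h := hind (Pi.single j c) (by
    rw [Finset.sum_eq_single j]
    · simpa [hj, poly_smul_def] using hc
    · intro i _ hi; simp [hi]
    · simp)
  simpa using congrFun h j

end WeylAlgebra

/-! ## The Pearcey system -/

namespace Pearcey

open WeylAlgebra RatFun3

attribute [local instance] polyModule

local notation "X₀" => (MvPolynomial.X 0 : MvPolynomial (Fin 3) ℂ)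
local notation "X₁" => (MvPolynomial.X 1 : MvPolynomial (Fin 3) ℂ)
local notation "X₂" => (MvPolynomial.X 2 : MvPolynomial (Fin 3) ℂ)

/-! ### Generic spanning of `M` by `1, ∂₁, ∂₂` -/

theorem P1_eq : P1 = (4 : MvPolynomial (Fin 3) ℂ) • (d 0 * d 1 : D) + (2 * X₂ * X₁) • (d 0 : D) +
    (X₂ ^ 2 * X₀) • (1 : D) := by
  simp only [poly_smul_def, map_mul, map_pow, map_ofNat, polyX_X, P1, mul_one, mul_assoc]

theorem P2_eq : P2 = (4 : MvPolynomial (Fin 3) ℂ) • (d 1 * d 1 : D) + (X₂ * X₀) • (d 0 : D) +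
    (2 * X₂ * X₁) • (d 1 : D) + X₂ • (1 : D) := by
  simp only [poly_smul_def, map_mul, map_ofNat, polyX_X, P2, mul_one, mul_assoc, pow_two]

theorem P3_eq : P3 = X₂ • (d 1 : D) - d 0 * d 0 := by
  simp only [poly_smul_def, polyX_X, P3, pow_two]

theorem P4_eq : P4 = (3 * X₀) • (d 0 : D) + (2 * X₁) • (d 1 : D) - (4 * X₂) • (d 2 : D) - 1 := by
  simp only [poly_smul_def, map_mul, map_ofNat, polyX_X, P4, mul_assoc]

theorem P1_mem : P1 ∈ I := Submodule.subset_span (by simp)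
theorem P2_mem : P2 ∈ I := Submodule.subset_span (by simp)
theorem P3_mem : P3 ∈ I := Submodule.subset_span (by simp)
theorem P4_mem : P4 ∈ I := Submodule.subset_span (by simp)

/-- The operators `1, ∂₁, ∂₂`. -/
noncomputable def basisOps : Fin 3 → WeylAlgebra 3 := ![1, d 0, d 1]

theorem d0_P4 : d 0 * P4 = (3 * X₀) • (d 0 * d 0 : D) + (2 * X₁) • (d 0 * d 1 : D) -
    (4 * X₂) • (d 0 * d 2 : D) + (2 : MvPolynomial (Fin 3) ℂ) • (d 0 : D) := by
  have h4 : MvPolynomial.pderiv (0 : Fin 3) (4 : MvPolynomial (Fin 3) ℂ) = 0 :=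
    Derivation.map_natCast _ 4
  have h3 : MvPolynomial.pderiv (0 : Fin 3) (3 : MvPolynomial (Fin 3) ℂ) = 0 :=
    Derivation.map_natCast _ 3
  have h2 : MvPolynomial.pderiv (0 : Fin 3) (2 : MvPolynomial (Fin 3) ℂ) = 0 :=
    Derivation.map_natCast _ 2
  rw [P4_eq, mul_sub, mul_sub, mul_add, d_mul_smul, d_mul_smul, d_mul_smul]
  simp [Derivation.leibniz, MvPolynomial.pderiv_X, h2, h3, h4, -smul_add]
  module

theorem d1_P4 : d 1 * P4 = (3 * X₀) • (d 0 * d 1 : D) + (2 * X₁) • (d 1 * d 1 : D) -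
    (4 * X₂) • (d 1 * d 2 : D) + (1 : MvPolynomial (Fin 3) ℂ) • (d 1 : D) := by
  have h4 : MvPolynomial.pderiv (1 : Fin 3) (4 : MvPolynomial (Fin 3) ℂ) = 0 :=
    Derivation.map_natCast _ 4
  have h3 : MvPolynomial.pderiv (1 : Fin 3) (3 : MvPolynomial (Fin 3) ℂ) = 0 :=
    Derivation.map_natCast _ 3
  have h2 : MvPolynomial.pderiv (1 : Fin 3) (2 : MvPolynomial (Fin 3) ℂ) = 0 :=
    Derivation.map_natCast _ 2
  rw [P4_eq, mul_sub, mul_sub, mul_add, d_mul_smul, d_mul_smul, d_mul_smul, d_comm 1 0]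
  simp [Derivation.leibniz, MvPolynomial.pderiv_X, h2, h3, h4, -smul_add]
  module

/-- `P₁, P₂, P₃` reduce `∂₁∂₂, ∂₂², ∂₁²`, then `P₄` reduces `∂_η`, and `∂₁P₄, ∂₂P₄` reduce `∂₁∂_η,
∂₂∂_η`. The only denominators are `4` and `4η`. -/
theorem mem_ratSpan_I (Q : D) : Q ∈ ratSpan I basisOps := by
  have e0 : (ratSpan I basisOps).mkQ 1 = 0 := mkQ_ratSpan_basis (0 : Fin 3)
  have e1 : (ratSpan I basisOps).mkQ (d 0) = 0 := mkQ_ratSpan_basis (1 : Fin 3)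
  have e2 : (ratSpan I basisOps).mkQ (d 1) = 0 := mkQ_ratSpan_basis (2 : Fin 3)
  have h1 := mkQ_ratSpan_mem (E := basisOps) P1_mem
  have h2 := mkQ_ratSpan_mem (E := basisOps) P2_mem
  have h3 := mkQ_ratSpan_mem (E := basisOps) P3_mem
  have h4 := mkQ_ratSpan_mem (E := basisOps) P4_mem
  have h5 := mkQ_ratSpan_mem (E := basisOps) (I.smul_mem (d 0) P4_mem)
  have h6 := mkQ_ratSpan_mem (E := basisOps) (I.smul_mem (d 1) P4_mem)
  rw [smul_eq_mul, d0_P4] at h5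
  rw [smul_eq_mul, d1_P4] at h6
  rw [P1_eq] at h1
  rw [P2_eq] at h2
  rw [P3_eq] at h3
  rw [P4_eq] at h4
  simp only [map_add, map_sub, map_smul, e0, e1, e2, smul_zero, add_zero, zero_sub,
    sub_zero, neg_eq_zero] at h1 h2 h3 h4 h5 h6
  have n4 : (4 : MvPolynomial (Fin 3) ℂ) ≠ 0 := by norm_num
  have n4X : 4 * X₂ ≠ 0 := mul_ne_zero n4 (MvPolynomial.X_ne_zero 2)
  have g1 := mkQ_ratSpan_eq_zero n4 h1
  have g2 := mkQ_ratSpan_eq_zero n4 h2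
  have g4 := mkQ_ratSpan_eq_zero n4X h4
  simp only [h3, g1, g2, smul_zero, add_zero, zero_sub, neg_eq_zero] at h5 h6
  have g5 := mkQ_ratSpan_eq_zero n4X h5
  have g6 := mkQ_ratSpan_eq_zero n4X h6
  refine mem_ratSpan (basis_mem_ratSpan (0 : Fin 3)) (fun i j => ?_) Q
  rw [← Submodule.Quotient.mk_eq_zero, ← Submodule.mkQ_apply]
  fin_cases i <;> fin_cases j <;>
    simp only [basisOps, Fin.zero_eta, Fin.mk_one, Fin.reduceFinMk, Matrix.cons_val, mul_one] <;>
    first | assumption | (rw [d_comm]; assumption)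

/-! ### The connection of rank three -/

local notation "x₀" => (var 0)
local notation "x₁" => (var 1)
local notation "η" => (var 2)

theorem var_ne_zero (i : Fin 3) : var i ≠ 0 := by
  rw [var, Ne, map_eq_zero_iff _ ofPoly_injective]
  exact MvPolynomial.X_ne_zero i

theorem partialD_two (i : Fin 3) : partialD i 2 = 0 := Derivation.map_natCast _ 2
theorem partialD_three (i : Fin 3) : partialD i 3 = 0 := Derivation.map_natCast _ 3
theorem partialD_four (i : Fin 3) : partialD i 4 = 0 := Derivation.map_natCast _ 4
theorem partialD_eight (i : Fin 3) : partialD i 8 = 0 := Derivation.map_natCast _ 8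
theorem partialD_sixteen (i : Fin 3) : partialD i 16 = 0 := Derivation.map_natCast _ 16

/-- `∂₁` in the basis `1, ∂₁, ∂₂`. -/
noncomputable def conn0 : Module.End ℂ (RatFun3 × RatFun3 × RatFun3) where
  toFun v := (partialD 0 v.1 - 4⁻¹ * (η ^ 2 * x₀) * v.2.2,
    partialD 0 v.2.1 + v.1 - 2⁻¹ * (η * x₁) * v.2.2, partialD 0 v.2.2 + η * v.2.1)
  map_add' v w := by ext <;> simp <;> ring
  map_smul' c v := by ext <;> simp [Algebra.smul_def] <;> ring

/-- `∂₂` in the basis `1, ∂₁, ∂₂`. -/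
noncomputable def conn1 : Module.End ℂ (RatFun3 × RatFun3 × RatFun3) where
  toFun v := (partialD 1 v.1 - 4⁻¹ * (η ^ 2 * x₀) * v.2.1 - 4⁻¹ * η * v.2.2,
    partialD 1 v.2.1 - 2⁻¹ * (η * x₁) * v.2.1 - 4⁻¹ * (η * x₀) * v.2.2,
    partialD 1 v.2.2 + v.1 - 2⁻¹ * (η * x₁) * v.2.2)
  map_add' v w := by ext <;> simp <;> ring
  map_smul' c v := by ext <;> simp [Algebra.smul_def] <;> ring

/-- `∂_η` in the basis `1, ∂₁, ∂₂`. -/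
noncomputable def conn2 : Module.End ℂ (RatFun3 × RatFun3 × RatFun3) where
  -- The coefficients of the three components reduce `∂_η, ∂_η∂₁, ∂_η∂₂` by means of `P₄, ∂₁P₄,
  -- ∂₂P₄` divided by `4η`, with second derivatives replaced through `P₁, P₂, P₃`.
  toFun v := (partialD 2 v.1 - 4⁻¹ * η⁻¹ * v.1 - 8⁻¹ * (η * x₀ * x₁) * v.2.1 -
      (3 * 16⁻¹ * (η * x₀ ^ 2) + 8⁻¹ * x₁) * v.2.2,
    partialD 2 v.2.1 + 3 * 4⁻¹ * (x₀ * η⁻¹) * v.1 + (2⁻¹ * η⁻¹ - 4⁻¹ * x₁ ^ 2) * v.2.1 -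
      2⁻¹ * (x₀ * x₁) * v.2.2,
    partialD 2 v.2.2 + 2⁻¹ * (x₁ * η⁻¹) * v.1 + 3 * 4⁻¹ * x₀ * v.2.1 +
      (4⁻¹ * η⁻¹ - 4⁻¹ * x₁ ^ 2) * v.2.2)
  map_add' v w := by ext <;> simp <;> ring
  map_smul' c v := by ext <;> simp [Algebra.smul_def] <;> ring

/-- Multiplication by a rational function. -/
noncomputable def mulRat (u : RatFun3) : Module.End ℂ (RatFun3 × RatFun3 × RatFun3) where
  toFun v := (u * v.1, u * v.2.1, u * v.2.2)
  map_add' v w := by ext <;> simp <;> ring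
  map_smul' c v := by ext <;> simp

theorem conn0_apply (a b c : RatFun3) : conn0 (a, b, c) = (partialD 0 a - 4⁻¹ * (η ^ 2 * x₀) * c,
    partialD 0 b + a - 2⁻¹ * (η * x₁) * c, partialD 0 c + η * b) := rfl

theorem conn1_apply (a b c : RatFun3) : conn1 (a, b, c) =
    (partialD 1 a - 4⁻¹ * (η ^ 2 * x₀) * b - 4⁻¹ * η * c,
    partialD 1 b - 2⁻¹ * (η * x₁) * b - 4⁻¹ * (η * x₀) * c,
    partialD 1 c + a - 2⁻¹ * (η * x₁) * c) := rfl

theorem conn2_apply (a b c : RatFun3) : conn2 (a, b, c) =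
    (partialD 2 a - 4⁻¹ * η⁻¹ * a - 8⁻¹ * (η * x₀ * x₁) * b -
      (3 * 16⁻¹ * (η * x₀ ^ 2) + 8⁻¹ * x₁) * c,
    partialD 2 b + 3 * 4⁻¹ * (x₀ * η⁻¹) * a + (2⁻¹ * η⁻¹ - 4⁻¹ * x₁ ^ 2) * b -
      2⁻¹ * (x₀ * x₁) * c,
    partialD 2 c + 2⁻¹ * (x₁ * η⁻¹) * a + 3 * 4⁻¹ * x₀ * b +
      (4⁻¹ * η⁻¹ - 4⁻¹ * x₁ ^ 2) * c) := rfl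

theorem mulRat_apply (u a b c : RatFun3) : mulRat u (a, b, c) = (u * a, u * b, u * c) := rfl

/-- This and the next two lemmas are the flatness of the connection, which is what makes it a module
over the Weyl algebra. -/
theorem conn01_comm (v : RatFun3 × RatFun3 × RatFun3) : conn0 (conn1 v) = conn1 (conn0 v) := by
  obtain ⟨a, b, c⟩ := v
  simp only [conn0_apply, conn1_apply, map_sub, map_add, Derivation.leibniz, smul_eq_mul,
    Derivation.leibniz_inv, Derivation.leibniz_pow, partialD_var, partialD_two, partialD_four,
    partialD_comm 1 0, Prod.mk.injEq, Fin.isValue, Fin.reduceEq, if_true, if_false, smul_zero,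
    mul_zero]
  refine ⟨?_, ?_, ?_⟩ <;> field_simp [var_ne_zero 2] <;> ring

theorem conn02_comm (v : RatFun3 × RatFun3 × RatFun3) : conn0 (conn2 v) = conn2 (conn0 v) := by
  obtain ⟨a, b, c⟩ := v
  have h := var_ne_zero 2
  simp only [conn0_apply, conn2_apply, map_sub, map_add, Derivation.leibniz, smul_eq_mul,
    Derivation.leibniz_inv, Derivation.leibniz_pow, partialD_var, partialD_two, partialD_three, partialD_four, partialD_eight, partialD_sixteen,
    partialD_comm 2 0, Prod.mk.injEq, Fin.isValue, Fin.reduceEq, if_true, if_false, smul_zero,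
    mul_zero]
  refine ⟨?_, ?_, ?_⟩ <;> field_simp <;> ring

theorem conn12_comm (v : RatFun3 × RatFun3 × RatFun3) : conn1 (conn2 v) = conn2 (conn1 v) := by
  obtain ⟨a, b, c⟩ := v
  have h := var_ne_zero 2
  simp only [conn1_apply, conn2_apply, map_sub, map_add, Derivation.leibniz, smul_eq_mul,
    Derivation.leibniz_inv, Derivation.leibniz_pow, partialD_var, partialD_two, partialD_three, partialD_four, partialD_eight, partialD_sixteen,
    partialD_comm 2 1, Prod.mk.injEq, Fin.isValue, Fin.reduceEq, if_true, if_false, smul_zero,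
    mul_zero]
  refine ⟨?_, ?_, ?_⟩ <;> field_simp <;> ring

theorem polyX_apply_mulRat (ρ : D →ₐ[ℂ] Module.End ℂ (RatFun3 × RatFun3 × RatFun3))
    (hρ : ∀ i, ρ (x i) = mulRat (var i)) (p : MvPolynomial (Fin 3) ℂ) :
    ρ (polyX 3 p) = mulRat (ofPoly p) := by
  induction p using MvPolynomial.induction_on with
  | C a =>
    rw [← MvPolynomial.algebraMap_eq, AlgHom.commutes, AlgHom.commutes, AlgHom.commutes]
    refine LinearMap.ext fun v => ?_
    rw [Module.algebraMap_end_apply]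
    ext <;> simp [mulRat, Algebra.smul_def]
  | add p q hp hq =>
    rw [map_add, map_add, map_add, hp, hq]
    refine LinearMap.ext fun v => ?_
    ext <;> simp [mulRat, add_mul]
  | mul_X p i hp =>
    rw [map_mul, map_mul, map_mul, hp, polyX_X, hρ]
    refine LinearMap.ext fun v => ?_
    ext <;> simp [mulRat, var, mul_assoc]

/-- The action of `D` on a vector space of dimension three over the field of rational functions
that is given by the connection in the basis `1, ∂₁, ∂₂`. -/
noncomputable def connRep : D →ₐ[ℂ] Module.End ℂ (RatFun3 × RatFun3 × RatFun3) :=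
  WeylAlgebra.lift (fun i => mulRat (var i)) ![conn0, conn1, conn2]
    (fun i j => LinearMap.ext fun ⟨a, b, c⟩ => by
      simp only [Module.End.mul_apply, mulRat_apply, mul_left_comm])
    (fun i j => LinearMap.ext fun v => by
      fin_cases i <;> fin_cases j <;>
        simp [Module.End.mul_apply, conn01_comm, conn02_comm, conn12_comm])
    (fun i j => LinearMap.ext fun ⟨a, b, c⟩ => by
      fin_cases i <;> fin_cases j <;>
        simp [Module.End.mul_apply, mulRat_apply, conn0_apply, conn1_apply, conn2_apply,
          Derivation.leibniz, partialD_var] <;>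
        refine ⟨?_, ?_, ?_⟩ <;> ring)

theorem connRep_x (i : Fin 3) : connRep (x i) = mulRat (var i) := lift_x ..
theorem connRep_d0 : connRep (d 0) = conn0 := lift_d ..
theorem connRep_d1 : connRep (d 1) = conn1 := lift_d ..
theorem connRep_d2 : connRep (d 2) = conn2 := lift_d ..

/-- The vector `(1, 0, 0)` plays the role of the class of `1` in `M`. -/
theorem connRep_basis {P : D} (hP : P ∈ I) : connRep P (1, 0, 0) = 0 := by
  have hη := var_ne_zero 2
  refine map_apply_eq_zero_of_mem_span connRep _ ?_ hP
  have a0 : conn0 (1, 0, 0) = (0, 1, 0) := by simp [conn0_apply]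
  have a1 : conn1 (1, 0, 0) = (0, 0, 1) := by simp [conn1_apply]
  have a00 : conn0 (0, 1, 0) = (0, 0, η) := by simp [conn0_apply]
  have a01 : conn0 (0, 0, 1) = (- 4⁻¹ * (η ^ 2 * x₀), - 2⁻¹ * (η * x₁), 0) := by
    simp [conn0_apply]
  have a11 : conn1 (0, 0, 1) = (- 4⁻¹ * η, - 4⁻¹ * (η * x₀), - 2⁻¹ * (η * x₁)) := by
    simp [conn1_apply]
  have a2 : conn2 (1, 0, 0) = (- 4⁻¹ * η⁻¹, 3 * 4⁻¹ * (x₀ * η⁻¹), 2⁻¹ * (x₁ * η⁻¹)) := by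
    simp [conn2_apply]
  have q2 : ∀ a b c, (2 : Module.End ℂ (RatFun3 × RatFun3 × RatFun3)) (a, b, c) =
      (2 * a, 2 * b, 2 * c) := fun a b c => by
    rw [Module.End.ofNat_apply]; simp [ofNat_smul_eq_nsmul, nsmul_eq_mul]
  have q3 : ∀ a b c, (3 : Module.End ℂ (RatFun3 × RatFun3 × RatFun3)) (a, b, c) =
      (3 * a, 3 * b, 3 * c) := fun a b c => by
    rw [Module.End.ofNat_apply]; simp [ofNat_smul_eq_nsmul, nsmul_eq_mul]
  have q4 : ∀ a b c, (4 : Module.End ℂ (RatFun3 × RatFun3 × RatFun3)) (a, b, c) =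
      (4 * a, 4 * b, 4 * c) := fun a b c => by
    rw [Module.End.ofNat_apply]; simp [ofNat_smul_eq_nsmul, nsmul_eq_mul]
  rintro P (rfl | rfl | rfl | rfl)
  · simp only [P1, map_add, map_mul, map_ofNat, connRep_x, connRep_d0, connRep_d1,
      LinearMap.add_apply, Module.End.mul_apply, pow_two, a0, a1, a01, mulRat_apply, q4, q2,
      Prod.mk_add_mk, Prod.mk_eq_zero]
    refine ⟨?_, ?_, ?_⟩ <;> ring
  · simp only [P2, map_add, map_mul, map_ofNat, connRep_x, connRep_d0, connRep_d1,
      LinearMap.add_apply, Module.End.mul_apply, pow_two, a0, a1, a11, mulRat_apply, q4, q2,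
      Prod.mk_add_mk, Prod.mk_eq_zero]
    refine ⟨?_, ?_, ?_⟩ <;> ring
  · simp only [P3, map_sub, map_mul, connRep_x, connRep_d0, connRep_d1,
      LinearMap.sub_apply, Module.End.mul_apply, pow_two, a0, a1, a00, mulRat_apply,
      Prod.mk_sub_mk, Prod.mk_eq_zero]
    refine ⟨?_, ?_, ?_⟩ <;> ring
  · simp only [P4, map_sub, map_add, map_mul, map_ofNat, map_one, connRep_x, connRep_d0,
      connRep_d1, connRep_d2, LinearMap.sub_apply, LinearMap.add_apply, Module.End.mul_apply, a0,
      a1, a2, mulRat_apply, q4, q3, q2, Prod.mk_sub_mk, Prod.mk_add_mk, Prod.mk_eq_zero,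
      Module.End.one_apply]
    refine ⟨?_, ?_, ?_⟩ <;> field_simp <;> ring

/-- `1, ∂₁, ∂₂` carry `(1, 0, 0)` to the standard basis, so the components of the image are the
coefficients of the relation. -/
theorem basisOps_independent_I (p : Fin 3 → MvPolynomial (Fin 3) ℂ)
    (hp : ∑ j, p j • basisOps j ∈ I) : p = 0 := by
  have h := connRep_basis hp
  have a0 : conn0 (1, 0, 0) = (0, 1, 0) := by simp [conn0_apply]
  have a1 : conn1 (1, 0, 0) = (0, 0, 1) := by simp [conn1_apply]
  simp only [Fin.sum_univ_three, basisOps, Matrix.cons_val, poly_smul_def, map_add, map_mul,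
    polyX_apply_mulRat connRep connRep_x, connRep_d0, connRep_d1, mul_one,
    LinearMap.add_apply, Module.End.mul_apply, a0, a1, mulRat_apply, Prod.mk_add_mk,
    Prod.mk_eq_zero, mul_zero, add_zero, zero_add, map_eq_zero_iff ofPoly ofPoly_injective] at h
  obtain ⟨h0, h1, h2⟩ := h
  funext j
  fin_cases j <;> assumption

theorem holonomicRank_M : holonomicRank 3 M = 3 := by
  simpa using holonomicRank_eq mem_ratSpan_I basisOps_independent_I

/-! ### The characteristic variety of `M` -/

/-- The symbols of `-P₃`, `P₂`, `P₄` are `ξ₁²`, `4ξ₂²` and `3x₁ξ₁ + 2x₂ξ₂ - 4ηξ_η`. Modulo a prime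
they leave `ξ₁ = ξ₂ = 0` with `η = 0` or `ξ_η = 0`, hence three generators. -/
theorem ringKrullDim_charIdeal_M_le :
    ringKrullDim (Symbols 3 ⧸ charIdeal (n := 3) ({I.mkQ 1} : Set M)) ≤ (3 : ℕ) := by
  have s0 : (MvPolynomial.C 1 * (MvPolynomial.X 0 * MvPolynomial.X 0) : Symbols 3) ∈
      charIdeal (n := 3) ({I.mkQ 1} : Set M) := by
    refine mem_charIdeal (k := 1) ?_ (I.neg_mem P3_mem) ?_ ?_
    · exact (MvPolynomial.isHomogeneous_C _ _).mul
        ((MvPolynomial.isHomogeneous_X _ _).mul (MvPolynomial.isHomogeneous_X _ _))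
    · rw [normalOrder_C_mul_X_mul_X, map_one, one_mul]
      exact (orderLE_d 0).mul (orderLE_d 0)
    · rw [normalOrder_C_mul_X_mul_X, map_one, one_mul, P3,
        show d 0 * d 0 - -(x 2 * d 1 - d 0 ^ 2) = (x 2 * d 1 : D) by noncomm_ring]
      exact (orderLE_x 2).mul (orderLE_d 1)
  have s1 : (MvPolynomial.C 4 * (MvPolynomial.X 1 * MvPolynomial.X 1) : Symbols 3) ∈
      charIdeal (n := 3) ({I.mkQ 1} : Set M) := by
    refine mem_charIdeal (k := 1) ?_ P2_mem ?_ ?_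
    · exact (MvPolynomial.isHomogeneous_C _ _).mul
        ((MvPolynomial.isHomogeneous_X _ _).mul (MvPolynomial.isHomogeneous_X _ _))
    · rw [normalOrder_C_mul_X_mul_X, map_ofNat]
      exact (OrderLE.ofNat 4).mul ((orderLE_d 1).mul (orderLE_d 1))
    · rw [normalOrder_C_mul_X_mul_X, map_ofNat, P2,
        show 4 * (d 1 * d 1) - (4 * d 1 ^ 2 + x 2 * x 0 * d 0 + 2 * x 2 * x 1 * d 1 + x 2) =
          (-(x 2 * x 0 * d 0 + 2 * x 2 * x 1 * d 1 + x 2) : D) by noncomm_ring]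
      exact (((((orderLE_x 2).mul (orderLE_x 0)).mul (orderLE_d 0)).add
        ((((OrderLE.ofNat 2).mul (orderLE_x 2)).mul (orderLE_x 1)).mul (orderLE_d 1))).add
        ((orderLE_x 2).mono (Nat.zero_le 1))).neg
  have s2 : (MvPolynomial.C (3 * X₀) * MvPolynomial.X 0 + MvPolynomial.C (2 * X₁) *
      MvPolynomial.X 1 - MvPolynomial.C (4 * X₂) * MvPolynomial.X 2 : Symbols 3) ∈
      charIdeal (n := 3) ({I.mkQ 1} : Set M) := by
    have e : normalOrder (MvPolynomial.C (3 * X₀) * MvPolynomial.X 0 + MvPolynomial.C (2 * X₁) *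
        MvPolynomial.X 1 - MvPolynomial.C (4 * X₂) * MvPolynomial.X 2 : Symbols 3) =
        3 * x 0 * d 0 + 2 * x 1 * d 1 - 4 * x 2 * d 2 := by
      simp only [normalOrder_sub, normalOrder_add, normalOrder_C_mul_X]
      simp only [map_mul, map_ofNat, polyX_X]
    have o : ∀ (i : Fin 3) (r : ℕ) [r.AtLeastTwo],
        OrderLE 1 (OfNat.ofNat r * x i * d i : D) := fun i r _ =>
      ((OrderLE.ofNat r).mul (orderLE_x i)).mul (orderLE_d i)
    refine mem_charIdeal (k := 0) ?_ P4_mem ?_ ?_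
    · have := fun (c : MvPolynomial (Fin 3) ℂ) (i : Fin 3) =>
        (MvPolynomial.isHomogeneous_C (Fin 3) c).mul (MvPolynomial.isHomogeneous_X _ i)
      exact ((this _ _).add (this _ _)).sub (this _ _)
    · rw [e]
      exact ((o 0 3).add (o 1 2)).sub (o 2 4)
    · rw [e, P4, sub_sub_cancel]
      exact OrderLE.one
  refine ringKrullDim_quotient_le_of_forall_isPrime fun P hP hle => ?_
  let φ : Symbols 3 →ₐ[ℂ] Symbols 3 ⧸ P := Ideal.Quotient.mkₐ ℂ P
  have hφ : Function.Surjective φ := Ideal.Quotient.mkₐ_surjective ℂ P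
  have hz : ∀ {p}, p ∈ charIdeal (n := 3) ({I.mkQ 1} : Set M) → φ p = 0 := fun hp =>
    Ideal.Quotient.eq_zero_iff_mem.mpr (hle hp)
  have ne : φ (MvPolynomial.C 4) ≠ 0 := by
    rw [map_ofNat, map_ofNat, ← map_ofNat (algebraMap ℂ (Symbols 3 ⧸ P)) 4]
    exact (map_ne_zero _).mpr (OfNat.ofNat_ne_zero 4)
  have z0 : φ (MvPolynomial.X 0) = 0 := by simpa using hz s0
  have z1 : φ (MvPolynomial.X 1) = 0 := by simpa [ne] using hz s1
  have z2 : φ (MvPolynomial.C X₂) = 0 ∨ φ (MvPolynomial.X 2) = 0 := by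
    simpa [z0, z1, ne] using hz s2
  rcases z2 with z2 | z2
  · refine ringKrullDim_le_of_isIntegralElem φ hφ
      ![φ (MvPolynomial.C X₀), φ (MvPolynomial.C X₁), φ (MvPolynomial.X 2)] ?_ ?_
    · intro i
      fin_cases i
      · exact isIntegralElem_aeval _ (Or.inr ⟨0, rfl⟩)
      · exact isIntegralElem_aeval _ (Or.inr ⟨1, rfl⟩)
      · exact isIntegralElem_aeval _ (Or.inl z2)
    · intro i
      fin_cases i
      · exact isIntegralElem_aeval _ (Or.inl z0)
      · exact isIntegralElem_aeval _ (Or.inl z1)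
      · exact isIntegralElem_aeval _ (Or.inr ⟨2, rfl⟩)
  · refine ringKrullDim_le_of_isIntegralElem φ hφ (fun i => φ (MvPolynomial.C (MvPolynomial.X i)))
      (fun i => isIntegralElem_aeval _ (Or.inr ⟨i, rfl⟩)) ?_
    intro i
    fin_cases i
    · exact isIntegralElem_aeval _ (Or.inl z0)
    · exact isIntegralElem_aeval _ (Or.inl z1)
    · exact isIntegralElem_aeval _ (Or.inl z2)

theorem isHolonomic_M : IsHolonomic 3 M :=
  isHolonomic_quotient (eq_zero_of_polyX_mem basisOps_independent_I (j := 0) rfl)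
    ringKrullDim_charIdeal_M_le

end Pearcey

/-! ## The Borel transformed Pearcey system -/

namespace Pearcey

open WeylAlgebra RatFun3

attribute [local instance] polyModule

local notation "X₀" => (MvPolynomial.X 0 : MvPolynomial (Fin 3) ℂ)
local notation "X₁" => (MvPolynomial.X 1 : MvPolynomial (Fin 3) ℂ)
local notation "X₂" => (MvPolynomial.X 2 : MvPolynomial (Fin 3) ℂ)

/-! ### Generic spanning of `M_B` by `1, ∂₁, ∂₂` -/

theorem borel_P1_eq : borel P1 = (4 : MvPolynomial (Fin 3) ℂ) • (d 0 * d 1 : DB) +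
    (2 * X₁) • (d 0 * d 2 : DB) + X₀ • (d 2 * d 2 : DB) := by
  simp only [poly_smul_def, map_mul, map_ofNat, polyX_X, borel_P1, mul_assoc, pow_two]

theorem borel_P2_eq : borel P2 = (4 : MvPolynomial (Fin 3) ℂ) • (d 1 * d 1 : DB) +
    X₀ • (d 0 * d 2 : DB) + (2 * X₁) • (d 1 * d 2 : DB) + d 2 := by
  simp only [poly_smul_def, map_mul, map_ofNat, polyX_X, borel_P2, mul_assoc, pow_two]

theorem borel_P3_eq : borel P3 = (d 1 * d 2 : DB) - d 0 * d 0 := by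
  rw [borel_P3, pow_two]

theorem borel_P4_eq : borel P4 = (3 * X₀) • (d 0 : DB) + (2 * X₁) • (d 1 : DB) +
    (4 * X₂) • (d 2 : DB) + (3 : MvPolynomial (Fin 3) ℂ) • (1 : DB) := by
  simp only [poly_smul_def, map_mul, map_ofNat, polyX_X, borel_P4, mul_assoc, mul_one]

theorem borel_P1_mem : borel P1 ∈ IB := Submodule.subset_span (by simp)
theorem borel_P2_mem : borel P2 ∈ IB := Submodule.subset_span (by simp)
theorem borel_P3_mem : borel P3 ∈ IB := Submodule.subset_span (by simp)
theorem borel_P4_mem : borel P4 ∈ IB := Submodule.subset_span (by simp)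

theorem d_mul_borel_P4 (i : Fin 3) : d i * borel P4 = (3 * X₀) • (d i * d 0 : DB) +
    (2 * X₁) • (d i * d 1 : DB) + (4 * X₂) • (d i * d 2 : DB) +
    ((3 * MvPolynomial.pderiv i X₀) • (d 0 : DB) + (2 * MvPolynomial.pderiv i X₁) • (d 1 : DB) +
    (4 * MvPolynomial.pderiv i X₂) • (d 2 : DB) + (3 : MvPolynomial (Fin 3) ℂ) • (d i : DB)) := by
  have h4 : MvPolynomial.pderiv i (4 : MvPolynomial (Fin 3) ℂ) = 0 := Derivation.map_natCast _ 4
  have h3 : MvPolynomial.pderiv i (3 : MvPolynomial (Fin 3) ℂ) = 0 := Derivation.map_natCast _ 3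
  have h2 : MvPolynomial.pderiv i (2 : MvPolynomial (Fin 3) ℂ) = 0 := Derivation.map_natCast _ 2
  rw [borel_P4_eq, mul_add, mul_add, mul_add, d_mul_smul, d_mul_smul, d_mul_smul, d_mul_smul,
    Derivation.leibniz, Derivation.leibniz, Derivation.leibniz, h2, h3, h4, mul_one]
  simp only [mul_zero, zero_smul, add_zero, smul_eq_mul]
  abel

/-- `P_{4,B}` reduces `∂_y`. The six second order monomials then satisfy six linear equations, from
`P_{1,B}, P_{2,B}, P_{3,B}` and the three derivatives of `P_{4,B}`, whose solution is generically
zero. -/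
theorem mem_ratSpan_IB (Q : DB) : Q ∈ ratSpan IB basisOps := by
  have e0 : (ratSpan IB basisOps).mkQ 1 = 0 := mkQ_ratSpan_basis (0 : Fin 3)
  have e1 : (ratSpan IB basisOps).mkQ (d 0) = 0 := mkQ_ratSpan_basis (1 : Fin 3)
  have e2 : (ratSpan IB basisOps).mkQ (d 1) = 0 := mkQ_ratSpan_basis (2 : Fin 3)
  have h1 := mkQ_ratSpan_mem (E := basisOps) borel_P1_mem
  have h2 := mkQ_ratSpan_mem (E := basisOps) borel_P2_mem
  have h3 := mkQ_ratSpan_mem (E := basisOps) borel_P3_mem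
  have h4 := mkQ_ratSpan_mem (E := basisOps) borel_P4_mem
  have h5 := mkQ_ratSpan_mem (E := basisOps) (IB.smul_mem (d 0) borel_P4_mem)
  have h6 := mkQ_ratSpan_mem (E := basisOps) (IB.smul_mem (d 1) borel_P4_mem)
  have h7 := mkQ_ratSpan_mem (E := basisOps) (IB.smul_mem (d 2) borel_P4_mem)
  rw [smul_eq_mul, d_mul_borel_P4] at h5 h6 h7
  rw [borel_P1_eq] at h1
  rw [borel_P2_eq] at h2
  rw [borel_P3_eq] at h3
  rw [borel_P4_eq] at h4
  rw [d_comm 1 0] at h6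
  rw [d_comm 2 0, d_comm 2 1] at h7
  have n4 : (4 : MvPolynomial (Fin 3) ℂ) ≠ 0 := by norm_num
  have n4X : 4 * X₂ ≠ 0 := mul_ne_zero n4 (MvPolynomial.X_ne_zero 2)
  simp only [map_add, map_smul, e0, e1, e2, smul_zero, add_zero, zero_add] at h4
  have e3 := mkQ_ratSpan_eq_zero n4X h4
  simp only [map_add, map_sub, map_smul, e1, e2, e3, smul_zero, add_zero] at h1 h2 h3 h5 h6 h7
  -- The scalar is the determinant of the system `hA`, `hB` below; it is nonzero because its value
  -- at `x₁ = x₂ = 0`, `y = 1` is `64²`.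
  have key : ∀ Q, (((64 * X₂ ^ 2 + 6 * X₀ ^ 2 * X₁ - 16 * X₁ ^ 2 * X₂) ^ 2 -
      (48 * X₀ * X₂ + 4 * X₀ * X₁ ^ 2) * (9 * X₀ ^ 3 - 32 * X₀ * X₁ * X₂)) •
        (ratSpan IB basisOps).mkQ Q = 0) → (ratSpan IB basisOps).mkQ Q = 0 := by
    refine fun Q => mkQ_ratSpan_eq_zero fun h => ?_
    have h' := congrArg (MvPolynomial.eval ![0, 0, 1]) h
    simp at h'
  have g1 := sub_eq_zero.mp h3
  rw [g1] at h2 h6 h7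
  generalize hs : (ratSpan IB basisOps).mkQ (d 0 * d 0) = a at *
  -- With `∂₂∂_y` identified with `∂₁²`, the combination `hA` eliminates `∂₂²` and `∂₁∂_y`, and `hB`
  -- eliminates `∂_y²` and `∂₁∂_y`. Cramer's rule then kills `∂₁²` and `∂₁∂₂`.
  have hA : (64 * X₂ ^ 2 + 6 * X₀ ^ 2 * X₁ - 16 * X₁ ^ 2 * X₂) • a +
      (48 * X₀ * X₂ + 4 * X₀ * X₁ ^ 2) • (ratSpan IB basisOps).mkQ (d 0 * d 1) = 0 := by
    linear_combination (norm := module) (16 * X₂) • h6 - (8 * X₁ * X₂) • h2 + (2 * X₀ * X₁) • h5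
  have hB : (9 * X₀ ^ 3 - 32 * X₀ * X₁ * X₂) • a +
      (64 * X₂ ^ 2 + 6 * X₀ ^ 2 * X₁ - 16 * X₁ ^ 2 * X₂) •
        (ratSpan IB basisOps).mkQ (d 0 * d 1) = 0 := by
    linear_combination (norm := module) (16 * X₂ ^ 2) • h1 - (4 * X₀ * X₂) • h7 -
      (8 * X₁ * X₂ - 3 * X₀ ^ 2) • h5
  have g0 : a = 0 := by
    rw [← hs]
    refine key _ ?_
    rw [hs]
    linear_combination (norm := module) (64 * X₂ ^ 2 + 6 * X₀ ^ 2 * X₁ - 16 * X₁ ^ 2 * X₂) • hA -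
      (48 * X₀ * X₂ + 4 * X₀ * X₁ ^ 2) • hB
  have g2 : (ratSpan IB basisOps).mkQ (d 0 * d 1) = 0 := by
    refine key _ ?_
    linear_combination (norm := module) (64 * X₂ ^ 2 + 6 * X₀ ^ 2 * X₁ - 16 * X₁ ^ 2 * X₂) • hB -
      (9 * X₀ ^ 3 - 32 * X₀ * X₁ * X₂) • hA
  rw [g0] at g1 hs
  simp only [g0, g2, smul_zero, add_zero, zero_add] at h2 h5 h7
  have g5 := mkQ_ratSpan_eq_zero n4X h5
  simp only [g5, smul_zero, add_zero, zero_add] at h2 h7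
  have g6 := mkQ_ratSpan_eq_zero n4 h2
  have g7 := mkQ_ratSpan_eq_zero n4X h7
  refine mem_ratSpan (basis_mem_ratSpan (0 : Fin 3)) (fun i j => ?_) Q
  rw [← Submodule.Quotient.mk_eq_zero, ← Submodule.mkQ_apply]
  fin_cases i <;> fin_cases j <;>
    simp only [basisOps, Fin.zero_eta, Fin.mk_one, Fin.reduceFinMk, Matrix.cons_val, mul_one] <;>
    first | assumption | (rw [d_comm]; assumption)

/-! ### The algebraic solution -/

local notation "t" => (var 0)
local notation "a₁" => (var 1)
local notation "a₂" => (var 2)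

/-- The derivative `4 t³ + 2 x₂ t + x₁` of the phase `t⁴ + x₂ t² + x₁ t`. -/
noncomputable def phaseDeriv : MvPolynomial (Fin 3) ℂ := 4 * X₀ ^ 3 + 2 * X₂ * X₀ + X₁

local notation "F" => (ofPoly phaseDeriv)

theorem ofPoly_phaseDeriv : F = 4 * t ^ 3 + 2 * a₂ * t + a₁ := by
  simp only [phaseDeriv, map_add, map_mul, map_pow, map_ofNat, var]

theorem phaseDeriv_ne_zero : F ≠ 0 := by
  rw [Ne, map_eq_zero_iff _ ofPoly_injective]
  intro h
  have h' := congrArg (MvPolynomial.eval ![0, 1, 0]) h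
  simp [phaseDeriv] at h'

/-- The derivations `∂₁, ∂₂, ∂_y` of the function field `ℂ(t, x₁, x₂)` over `ℂ(x₁, x₂, y)`, where
`y = -(t⁴ + x₂ t² + x₁ t)`. -/
noncomputable def phaseDer : Fin 3 → Derivation ℂ RatFun3 RatFun3 :=
  -- Implicit differentiation of `t⁴ + x₂t² + x₁t + y = 0` gives `∂₁t = -t/F`, `∂₂t = -t²/F`, `∂_y t
  -- = -1/F`.
  ![partialD 1 - (t * F⁻¹) • partialD 0, partialD 2 - (t ^ 2 * F⁻¹) • partialD 0,
    -F⁻¹ • partialD 0]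

/-- The variables `x₁, x₂, y` as polynomials in `t, x₁, x₂`. -/
noncomputable def phaseVar : Fin 3 → MvPolynomial (Fin 3) ℂ :=
  ![X₁, X₂, -(X₀ ^ 4 + X₂ * X₀ ^ 2 + X₁ * X₀)]

theorem phaseDer_zero (u : RatFun3) :
    phaseDer 0 u = partialD 1 u - t * F⁻¹ * partialD 0 u := rfl

theorem phaseDer_one (u : RatFun3) :
    phaseDer 1 u = partialD 2 u - t ^ 2 * F⁻¹ * partialD 0 u := rfl

theorem phaseDer_two (u : RatFun3) : phaseDer 2 u = -F⁻¹ * partialD 0 u := rfl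

theorem derivation_phaseDeriv (δ : Derivation ℂ RatFun3 RatFun3) :
    δ F = (12 * t ^ 2 + 2 * a₂) * δ t + 2 * t * δ a₂ + δ a₁ := by
  have h4 : δ 4 = 0 := Derivation.map_natCast _ 4
  have h2 : δ 2 = 0 := Derivation.map_natCast _ 2
  rw [ofPoly_phaseDeriv]
  simp only [map_add, Derivation.leibniz, Derivation.leibniz_pow, h4, h2, smul_eq_mul]
  simp only [nsmul_eq_mul]
  push_cast
  ring

theorem phaseDer_zero_t : phaseDer 0 t = -(t * F⁻¹) := by simp [phaseDer_zero, partialD_var]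
theorem phaseDer_zero_a1 : phaseDer 0 a₁ = 1 := by simp [phaseDer_zero, partialD_var]
theorem phaseDer_zero_a2 : phaseDer 0 a₂ = 0 := by simp [phaseDer_zero, partialD_var]
theorem phaseDer_one_t : phaseDer 1 t = -(t ^ 2 * F⁻¹) := by simp [phaseDer_one, partialD_var]
theorem phaseDer_one_a1 : phaseDer 1 a₁ = 0 := by simp [phaseDer_one, partialD_var]
theorem phaseDer_one_a2 : phaseDer 1 a₂ = 1 := by simp [phaseDer_one, partialD_var]
theorem phaseDer_two_t : phaseDer 2 t = -F⁻¹ := by simp [phaseDer_two, partialD_var]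
theorem phaseDer_two_a1 : phaseDer 2 a₁ = 0 := by simp [phaseDer_two, partialD_var]
theorem phaseDer_two_a2 : phaseDer 2 a₂ = 0 := by simp [phaseDer_two, partialD_var]

theorem phaseDer_comm_zero_one (u : RatFun3) :
    phaseDer 0 (phaseDer 1 u) = phaseDer 1 (phaseDer 0 u) := by
  have hF := phaseDeriv_ne_zero
  refine derivation_commute (fun k => ?_) u
  fin_cases k
  · simp only [Fin.zero_eta, phaseDer_zero_t, phaseDer_zero_a1, phaseDer_zero_a2, phaseDer_one_t,
      phaseDer_one_a1, phaseDer_one_a2, Derivation.leibniz, Derivation.leibniz_inv,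
      Derivation.leibniz_pow, derivation_phaseDeriv, map_neg, smul_eq_mul, nsmul_eq_mul]
    push_cast
    field_simp
    ring
  · simp [phaseDer_zero_a1, phaseDer_one_a1]
  · simp [phaseDer_zero_a2, phaseDer_one_a2]

theorem phaseDer_comm_zero_two (u : RatFun3) :
    phaseDer 0 (phaseDer 2 u) = phaseDer 2 (phaseDer 0 u) := by
  have hF := phaseDeriv_ne_zero
  refine derivation_commute (fun k => ?_) u
  fin_cases k
  · simp only [Fin.zero_eta, phaseDer_zero_t, phaseDer_zero_a1, phaseDer_zero_a2, phaseDer_two_t,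
      phaseDer_two_a1, phaseDer_two_a2, Derivation.leibniz, Derivation.leibniz_inv,
      derivation_phaseDeriv, map_neg, smul_eq_mul]
    field_simp
    ring
  · simp [phaseDer_zero_a1, phaseDer_two_a1]
  · simp [phaseDer_zero_a2, phaseDer_two_a2]

theorem phaseDer_comm_one_two (u : RatFun3) :
    phaseDer 1 (phaseDer 2 u) = phaseDer 2 (phaseDer 1 u) := by
  have hF := phaseDeriv_ne_zero
  refine derivation_commute (fun k => ?_) u
  fin_cases k
  · simp only [Fin.zero_eta, phaseDer_one_t, phaseDer_one_a1, phaseDer_one_a2, phaseDer_two_t,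
      phaseDer_two_a1, phaseDer_two_a2, Derivation.leibniz, Derivation.leibniz_inv,
      Derivation.leibniz_pow, derivation_phaseDeriv, map_neg, smul_eq_mul, nsmul_eq_mul]
    push_cast
    field_simp
    ring
  · simp [phaseDer_one_a1, phaseDer_two_a1]
  · simp [phaseDer_one_a2, phaseDer_two_a2]

theorem phaseDer_comm (i j : Fin 3) (u : RatFun3) :
    phaseDer i (phaseDer j u) = phaseDer j (phaseDer i u) := by
  fin_cases i <;> fin_cases j <;>
    simp only [Fin.zero_eta, Fin.mk_one, Fin.reduceFinMk, phaseDer_comm_zero_one,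
      phaseDer_comm_zero_two, phaseDer_comm_one_two]

theorem ofPoly_phaseVar_zero : ofPoly (phaseVar 0) = a₁ := rfl
theorem ofPoly_phaseVar_one : ofPoly (phaseVar 1) = a₂ := rfl
theorem ofPoly_phaseVar_two : ofPoly (phaseVar 2) = -(t ^ 4 + a₂ * t ^ 2 + a₁ * t) := by
  simp [phaseVar, var]

/-- The derivations are dual to `x₁, x₂, y`; this is the relation between `d i` and `x j` in the
representation below. -/
theorem phaseDer_phaseVar (i j : Fin 3) :
    phaseDer i (ofPoly (phaseVar j)) = if i = j then 1 else 0 := by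
  have hF := phaseDeriv_ne_zero
  fin_cases i <;> fin_cases j <;>
    simp [ofPoly_phaseVar_zero, ofPoly_phaseVar_one, ofPoly_phaseVar_two,
      phaseDer_zero_t, phaseDer_zero_a1, phaseDer_zero_a2, phaseDer_one_t, phaseDer_one_a1,
      phaseDer_one_a2, phaseDer_two_t, phaseDer_two_a1,
      phaseDer_two_a2, Derivation.leibniz, Derivation.leibniz_pow] <;>
    field_simp <;> rw [ofPoly_phaseDeriv] <;> ring

/-- The action of `D_B` on the function field `ℂ(t, x₁, x₂)`. -/
noncomputable def phaseRep : DB →ₐ[ℂ] Module.End ℂ RatFun3 :=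
  WeylAlgebra.lift (fun i => LinearMap.mulLeft ℂ (ofPoly (phaseVar i)))
    (fun i => (phaseDer i : RatFun3 →ₗ[ℂ] RatFun3))
    (fun i j => LinearMap.ext fun u => by
      simp only [Module.End.mul_apply, LinearMap.mulLeft_apply, mul_left_comm])
    (fun i j => LinearMap.ext fun u => phaseDer_comm i j u)
    (fun i j => LinearMap.ext fun u => by
      have h := phaseDer_phaseVar i j
      by_cases hij : i = j <;>
        simp [hij, Module.End.mul_apply, Derivation.leibniz] at h ⊢ <;> simp [h])

theorem phaseRep_x (i : Fin 3) (u : RatFun3) : phaseRep (x i) u = ofPoly (phaseVar i) * u := by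
  rw [phaseRep, lift_x, LinearMap.mulLeft_apply]

theorem phaseRep_d (i : Fin 3) (u : RatFun3) : phaseRep (d i) u = phaseDer i u := by
  rw [phaseRep, lift_d]; rfl

theorem phaseRep_polyX (p : MvPolynomial (Fin 3) ℂ) (u : RatFun3) :
    phaseRep (polyX 3 p) u = ofPoly (MvPolynomial.aeval phaseVar p) * u := by
  induction p using MvPolynomial.induction_on generalizing u with
  | C a =>
    rw [← MvPolynomial.algebraMap_eq, AlgHom.commutes, AlgHom.commutes, AlgHom.commutes,
      AlgHom.commutes, Module.algebraMap_end_apply, Algebra.smul_def]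
  | add p q hp hq =>
    simp only [map_add, LinearMap.add_apply, hp, hq, add_mul]
  | mul_X p i hp =>
    rw [map_mul, map_mul, Module.End.mul_apply, hp, polyX_X, phaseRep_x, map_mul, map_mul,
      MvPolynomial.aeval_X, mul_assoc]

theorem phaseDer_zero_inv : phaseDer 0 F⁻¹ =
    (t * (12 * t ^ 2 + 2 * a₂) - F) * F⁻¹ ^ 3 := by
  have hF := phaseDeriv_ne_zero
  simp only [Derivation.leibniz_inv, derivation_phaseDeriv, phaseDer_zero_t, phaseDer_zero_a1,
    phaseDer_zero_a2, smul_eq_mul]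
  field_simp
  ring

theorem phaseDer_one_inv : phaseDer 1 F⁻¹ =
    (t ^ 2 * (12 * t ^ 2 + 2 * a₂) - 2 * t * F) * F⁻¹ ^ 3 := by
  have hF := phaseDeriv_ne_zero
  simp only [Derivation.leibniz_inv, derivation_phaseDeriv, phaseDer_one_t, phaseDer_one_a1,
    phaseDer_one_a2, smul_eq_mul]
  field_simp
  ring

theorem phaseDer_two_inv : phaseDer 2 F⁻¹ = (12 * t ^ 2 + 2 * a₂) * F⁻¹ ^ 3 := by
  have hF := phaseDeriv_ne_zero
  simp only [Derivation.leibniz_inv, derivation_phaseDeriv, phaseDer_two_t, phaseDer_two_a1,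
    phaseDer_two_a2, smul_eq_mul]
  field_simp
  ring

theorem phaseRep_ofNat (r : ℕ) [r.AtLeastTwo] (u : RatFun3) :
    phaseRep ofNat(r) u = ofNat(r) * u := by
  rw [map_ofNat, Module.End.ofNat_apply, ← Nat.cast_smul_eq_nsmul RatFun3, smul_eq_mul,
    Nat.cast_ofNat]

/-- Substituting `y = -(t⁴ + x₂t² + x₁t)` turns the Pearcey integral into `∫ e^{-ηy} (∂t/∂y) dy`,
and `∂t/∂y = -1/F`. This predicts that `1/F` solves the Borel transformed system; the proof checks
the four generators directly. -/
theorem phaseRep_inv {P : DB} (hP : P ∈ IB) : phaseRep P F⁻¹ = 0 := by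
  have hF := phaseDeriv_ne_zero
  refine map_apply_eq_zero_of_mem_span phaseRep _ ?_ hP
  have hn : ∀ i, phaseDer i 12 = 0 := fun i => Derivation.map_natCast _ 12
  have hn2 : ∀ i, phaseDer i 2 = 0 := fun i => Derivation.map_natCast _ 2
  rintro P (rfl | rfl | rfl | rfl)
  · simp only [borel_P1, pow_two, map_add, map_mul, LinearMap.add_apply, Module.End.mul_apply,
      phaseRep_ofNat, phaseRep_x, phaseRep_d, phaseDer_one_inv, phaseDer_two_inv,
      ofPoly_phaseVar_zero, ofPoly_phaseVar_one]
    simp only [Derivation.leibniz, Derivation.leibniz_inv, Derivation.leibniz_pow, map_add, map_sub,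
      derivation_phaseDeriv, phaseDer_zero_t, phaseDer_zero_a1, phaseDer_zero_a2, phaseDer_two_t,
      phaseDer_two_a1, phaseDer_two_a2, hn, hn2, smul_eq_mul, nsmul_eq_mul, Nat.reduceSub]
    push_cast
    field_simp
    rw [ofPoly_phaseDeriv]
    ring
  · simp only [borel_P2, pow_two, map_add, map_mul, LinearMap.add_apply, Module.End.mul_apply,
      phaseRep_ofNat, phaseRep_x, phaseRep_d, phaseDer_one_inv, phaseDer_two_inv,
      ofPoly_phaseVar_zero, ofPoly_phaseVar_one]
    simp only [Derivation.leibniz, Derivation.leibniz_inv, Derivation.leibniz_pow, map_add, map_sub,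
      derivation_phaseDeriv, phaseDer_zero_t, phaseDer_zero_a1, phaseDer_zero_a2, phaseDer_one_t,
      phaseDer_one_a1, phaseDer_one_a2, hn, hn2, smul_eq_mul, nsmul_eq_mul, Nat.reduceSub]
    push_cast
    field_simp
    rw [ofPoly_phaseDeriv]
    ring
  · simp only [borel_P3, pow_two, map_sub, map_mul, LinearMap.sub_apply, Module.End.mul_apply,
      phaseRep_d, phaseDer_zero_inv, phaseDer_two_inv]
    simp only [Derivation.leibniz, Derivation.leibniz_inv, Derivation.leibniz_pow, map_add, map_sub,
      derivation_phaseDeriv, phaseDer_zero_t, phaseDer_zero_a1, phaseDer_zero_a2, phaseDer_one_t,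
      phaseDer_one_a1, phaseDer_one_a2, hn, hn2, smul_eq_mul, nsmul_eq_mul, Nat.reduceSub]
    push_cast
    field_simp
    ring
  · simp only [borel_P4, map_add, map_mul, LinearMap.add_apply, Module.End.mul_apply,
      phaseRep_ofNat, phaseRep_x, phaseRep_d, phaseDer_zero_inv, phaseDer_one_inv,
      phaseDer_two_inv, ofPoly_phaseVar_zero, ofPoly_phaseVar_one, ofPoly_phaseVar_two]
    field_simp
    rw [ofPoly_phaseDeriv]
    ring

end Pearcey

/-- Polynomials with pairwise incongruent degrees are linearly independent. -/
theorem Polynomial.eq_zero_of_sum_eq_zero_of_natDegree_mod {R : Type*} [CommRing R] [IsDomain R]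
    {m : ℕ} {ι : Type*} [Fintype ι] {p q : ι → Polynomial R} (hp : ∀ i, m ∣ (p i).natDegree)
    (hq0 : ∀ i, q i ≠ 0) (hq : Function.Injective fun i => (q i).natDegree % m)
    (h : ∑ i, p i * q i = 0) (i : ι) : p i = 0 := by
  -- A nonzero term has degree congruent to that of `q i` modulo `m`, so nonzero terms have distinct
  -- degrees and cannot cancel.
  have hd := Polynomial.degree_sum_eq_of_disjoint (fun i => p i * q i) Finset.univ (by
    rintro i ⟨-, hi⟩ j ⟨-, hj⟩ hij he
    refine hij (hq ?_)
    have he' := Polynomial.natDegree_eq_of_degree_eq he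
    rw [Polynomial.natDegree_mul (left_ne_zero_of_mul hi) (hq0 i),
      Polynomial.natDegree_mul (left_ne_zero_of_mul hj) (hq0 j)] at he'
    obtain ⟨a, ha⟩ := hp i
    obtain ⟨b, hb⟩ := hp j
    have h1 := congrArg (· % m) he'
    simpa [ha, hb] using h1)
  rw [h, Polynomial.degree_zero] at hd
  have hi := (Finset.sup_eq_bot_iff _ _).mp hd.symm i (Finset.mem_univ i)
  exact (mul_eq_zero.mp (Polynomial.degree_eq_bot.mp hi)).resolve_right (hq0 i)

namespace Pearcey

open WeylAlgebra RatFun3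

attribute [local instance] polyModule

local notation "X₀" => (MvPolynomial.X 0 : MvPolynomial (Fin 3) ℂ)
local notation "X₁" => (MvPolynomial.X 1 : MvPolynomial (Fin 3) ℂ)
local notation "X₂" => (MvPolynomial.X 2 : MvPolynomial (Fin 3) ℂ)

/-! ### Independence over the field of rational functions in `x₁, x₂, y` -/

local notation "T" => (Polynomial.X : Polynomial (MvPolynomial (Fin 2) ℂ))
local notation "b₁" => (Polynomial.C (MvPolynomial.X 0) : Polynomial (MvPolynomial (Fin 2) ℂ))
local notation "b₂" => (Polynomial.C (MvPolynomial.X 1) : Polynomial (MvPolynomial (Fin 2) ℂ))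

theorem finSuccEquiv_X0 : MvPolynomial.finSuccEquiv ℂ 2 X₀ = T := MvPolynomial.finSuccEquiv_X_zero
theorem finSuccEquiv_X1 : MvPolynomial.finSuccEquiv ℂ 2 X₁ = b₁ :=
  MvPolynomial.finSuccEquiv_X_succ (j := 0)
theorem finSuccEquiv_X2 : MvPolynomial.finSuccEquiv ℂ 2 X₂ = b₂ :=
  MvPolynomial.finSuccEquiv_X_succ (j := 1)

theorem natDegree_phase : (-(T ^ 4 + b₂ * T ^ 2 + b₁ * T)).natDegree = 4 := by
  compute_degree!

/-- Polynomials in `x₁, x₂, y` as polynomials in `y` over `ℂ[x₁, x₂]`. -/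
noncomputable def lastVarEquiv :
    MvPolynomial (Fin 3) ℂ ≃ₐ[ℂ] Polynomial (MvPolynomial (Fin 2) ℂ) :=
  -- The rotation moves index 2, the variable `y`, to index 0, which `finSuccEquiv` turns into the
  -- polynomial variable.
  (MvPolynomial.renameEquiv ℂ (finRotate 3)).trans (MvPolynomial.finSuccEquiv ℂ 2)

theorem lastVarEquiv_X0 : lastVarEquiv X₀ = b₁ := by
  rw [lastVarEquiv, AlgEquiv.trans_apply, MvPolynomial.renameEquiv_apply, MvPolynomial.rename_X]
  exact finSuccEquiv_X1

theorem lastVarEquiv_X1 : lastVarEquiv X₁ = b₂ := by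
  rw [lastVarEquiv, AlgEquiv.trans_apply, MvPolynomial.renameEquiv_apply, MvPolynomial.rename_X]
  exact finSuccEquiv_X2

theorem lastVarEquiv_X2 : lastVarEquiv X₂ = T := by
  rw [lastVarEquiv, AlgEquiv.trans_apply, MvPolynomial.renameEquiv_apply, MvPolynomial.rename_X]
  exact finSuccEquiv_X0

theorem finSuccEquiv_phaseVar : ∀ i, MvPolynomial.finSuccEquiv ℂ 2 (phaseVar i) =
    (lastVarEquiv (MvPolynomial.X i)).comp (-(T ^ 4 + b₂ * T ^ 2 + b₁ * T))
  | 0 => by rw [lastVarEquiv_X0, Polynomial.C_comp]; exact finSuccEquiv_X1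
  | 1 => by rw [lastVarEquiv_X1, Polynomial.C_comp]; exact finSuccEquiv_X2
  | 2 => by
    rw [lastVarEquiv_X2, Polynomial.X_comp,
      show phaseVar 2 = -(X₀ ^ 4 + X₂ * X₀ ^ 2 + X₁ * X₀) from rfl, map_neg, map_add, map_add,
      map_mul, map_mul, map_pow, map_pow, finSuccEquiv_X0, finSuccEquiv_X1, finSuccEquiv_X2]

/-- Viewed in `t`, inserting `x₁, x₂, y` is composition with a polynomial of degree 4, so all
resulting degrees in `t` are multiples of 4. -/
theorem finSuccEquiv_aeval_phaseVar (p : MvPolynomial (Fin 3) ℂ) :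
    MvPolynomial.finSuccEquiv ℂ 2 (MvPolynomial.aeval phaseVar p) =
      (lastVarEquiv p).comp (-(T ^ 4 + b₂ * T ^ 2 + b₁ * T)) := by
  induction p using MvPolynomial.induction_on with
  | C a =>
    rw [← MvPolynomial.algebraMap_eq, AlgHom.commutes, AlgEquiv.commutes, AlgEquiv.commutes,
      IsScalarTower.algebraMap_apply ℂ (MvPolynomial (Fin 2) ℂ), Polynomial.algebraMap_eq,
      Polynomial.C_comp]
  | add p q hp hq => rw [map_add, map_add, map_add, Polynomial.add_comp, hp, hq]
  | mul_X p i hp =>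
    rw [map_mul, map_mul, map_mul, Polynomial.mul_comp, hp, MvPolynomial.aeval_X]
    rw [finSuccEquiv_phaseVar]

theorem four_dvd_natDegree_phase (p : MvPolynomial (Fin 3) ℂ) :
    4 ∣ (MvPolynomial.finSuccEquiv ℂ 2 (MvPolynomial.aeval phaseVar p)).natDegree := by
  rw [finSuccEquiv_aeval_phaseVar, Polynomial.natDegree_comp, natDegree_phase]
  exact dvd_mul_left _ _

theorem aeval_phaseVar_injective :
    Function.Injective (MvPolynomial.aeval phaseVar : MvPolynomial (Fin 3) ℂ →ₐ[ℂ] _) := by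
  rw [injective_iff_map_eq_zero]
  intro p hp
  have h := finSuccEquiv_aeval_phaseVar p
  rw [hp, map_zero, eq_comm, Polynomial.comp_eq_zero_iff] at h
  rcases h with h | ⟨-, h⟩
  · exact (map_eq_zero_iff _ lastVarEquiv.injective).mp h
  · have h' := natDegree_phase
    rw [h, Polynomial.natDegree_C] at h'
    omega

/-- Applied to `1/F` and multiplied by `F³`, a relation combines `F²`, `8t³ - x₁` and `4t⁴ - 2x₂t² -
2x₁t`. Their degrees 6, 3, 4 in `t` are incongruent modulo 4, whereas coefficients in `x₁, x₂, y`
have degrees divisible by 4. -/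
theorem basisOps_independent_IB (p : Fin 3 → MvPolynomial (Fin 3) ℂ)
    (hp : ∑ j, p j • basisOps j ∈ IB) : p = 0 := by
  have h := phaseRep_inv hp
  have hF := phaseDeriv_ne_zero
  simp only [Fin.sum_univ_three, basisOps, Matrix.cons_val, poly_smul_def, map_add, map_mul,
    mul_one, LinearMap.add_apply, Module.End.mul_apply, phaseRep_polyX, phaseRep_d,
    phaseDer_zero_inv, phaseDer_one_inv] at h
  field_simp at h
  have h1 : MvPolynomial.aeval phaseVar (p 0) * phaseDeriv ^ 2 +
      MvPolynomial.aeval phaseVar (p 1) * (X₀ * (12 * X₀ ^ 2 + 2 * X₂) - phaseDeriv) +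
      MvPolynomial.aeval phaseVar (p 2) *
        (X₀ ^ 2 * (12 * X₀ ^ 2 + 2 * X₂) - 2 * X₀ * phaseDeriv) = 0 := by
    refine ofPoly_injective ?_
    simp only [map_add, map_mul, map_sub, map_pow, map_ofNat, map_zero]
    simp only [var] at h
    linear_combination h
  have h2 := congrArg (MvPolynomial.finSuccEquiv ℂ 2) h1
  simp only [phaseDeriv, map_add, map_mul, map_sub, map_pow, map_ofNat, map_zero, finSuccEquiv_X0,
    finSuccEquiv_X1, finSuccEquiv_X2] at h2
  have d0 : ((4 * T ^ 3 + 2 * b₂ * T + b₁) ^ 2).natDegree = 6 := by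
    have d : (4 * T ^ 3 + 2 * b₂ * T + b₁).natDegree = 3 := by compute_degree!
    rw [Polynomial.natDegree_pow, d]
  have d1 : (T * (12 * T ^ 2 + 2 * b₂) - (4 * T ^ 3 + 2 * b₂ * T + b₁)).natDegree = 3 := by
    rw [show T * (12 * T ^ 2 + 2 * b₂) - (4 * T ^ 3 + 2 * b₂ * T + b₁) = 8 * T ^ 3 - b₁ by ring]
    compute_degree!
  have d2 : (T ^ 2 * (12 * T ^ 2 + 2 * b₂) -
      2 * T * (4 * T ^ 3 + 2 * b₂ * T + b₁)).natDegree = 4 := by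
    rw [show T ^ 2 * (12 * T ^ 2 + 2 * b₂) - 2 * T * (4 * T ^ 3 + 2 * b₂ * T + b₁) =
      4 * T ^ 4 - 2 * b₂ * T ^ 2 - 2 * b₁ * T by ring]
    compute_degree!
  have h3 := Polynomial.eq_zero_of_sum_eq_zero_of_natDegree_mod (m := 4)
    (p := fun j => MvPolynomial.finSuccEquiv ℂ 2 (MvPolynomial.aeval phaseVar (p j)))
    (q := ![(4 * T ^ 3 + 2 * b₂ * T + b₁) ^ 2,
      T * (12 * T ^ 2 + 2 * b₂) - (4 * T ^ 3 + 2 * b₂ * T + b₁),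
      T ^ 2 * (12 * T ^ 2 + 2 * b₂) - 2 * T * (4 * T ^ 3 + 2 * b₂ * T + b₁)])
    (fun j => four_dvd_natDegree_phase (p j))
    (fun j => by
      refine fun h0 => ?_
      fin_cases j
      · have h0' : (4 * T ^ 3 + 2 * b₂ * T + b₁) ^ 2 = 0 := h0
        rw [h0'] at d0
        simp at d0
      · have h0' : T * (12 * T ^ 2 + 2 * b₂) - (4 * T ^ 3 + 2 * b₂ * T + b₁) = 0 := h0
        rw [h0'] at d1
        simp at d1
      · have h0' : T ^ 2 * (12 * T ^ 2 + 2 * b₂) -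
          2 * T * (4 * T ^ 3 + 2 * b₂ * T + b₁) = 0 := h0
        rw [h0'] at d2
        simp at d2)
    (by
      intro i j hij
      fin_cases i <;> fin_cases j <;>
        simp only [Fin.zero_eta, Fin.mk_one, Fin.reduceFinMk, Matrix.cons_val, d0, d1, d2] at hij ⊢ <;>
        omega)
    (by simpa [Fin.sum_univ_three] using h2)
  funext j
  refine aeval_phaseVar_injective ?_
  rw [Pi.zero_apply, map_zero]
  exact (map_eq_zero_iff _ (MvPolynomial.finSuccEquiv ℂ 2).injective).mp (h3 j)

theorem holonomicRank_MB : holonomicRank 3 MB = 3 := by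
  simpa using holonomicRank_eq mem_ratSpan_IB basisOps_independent_IB

/-! ### The characteristic variety of `M_B` -/

section CharIdeal

local notation "ξ₀" => (MvPolynomial.X 0 : Symbols 3)
local notation "ξ₁" => (MvPolynomial.X 1 : Symbols 3)
local notation "ξ₂" => (MvPolynomial.X 2 : Symbols 3)

theorem isHomogeneous_C_mul_X (c : MvPolynomial (Fin 3) ℂ) (i : Fin 3) :
    (MvPolynomial.C c * MvPolynomial.X i : Symbols 3).IsHomogeneous (0 + 1) :=
  (MvPolynomial.isHomogeneous_C _ _).mul (MvPolynomial.isHomogeneous_X _ _)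

theorem isHomogeneous_C_mul_X_mul_X (c : MvPolynomial (Fin 3) ℂ) (i j : Fin 3) :
    (MvPolynomial.C c * (MvPolynomial.X i * MvPolynomial.X j) : Symbols 3).IsHomogeneous (1 + 1) :=
  (MvPolynomial.isHomogeneous_C _ _).mul
    ((MvPolynomial.isHomogeneous_X _ _).mul (MvPolynomial.isHomogeneous_X _ _))

theorem symbol_borel_P1_mem :
    (MvPolynomial.C 4 * (ξ₀ * ξ₁) + MvPolynomial.C (2 * X₁) * (ξ₀ * ξ₂) +
      MvPolynomial.C X₀ * (ξ₂ * ξ₂) : Symbols 3) ∈ charIdeal (n := 3) ({IB.mkQ 1} : Set MB) := by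
  have e : normalOrder (MvPolynomial.C 4 * (ξ₀ * ξ₁) + MvPolynomial.C (2 * X₁) * (ξ₀ * ξ₂) +
      MvPolynomial.C X₀ * (ξ₂ * ξ₂)) =
      4 * (d 0 * d 1) + 2 * x 1 * (d 0 * d 2) + x 0 * (d 2 * d 2) := by
    simp only [normalOrder_add, normalOrder_C_mul_X_mul_X]
    simp only [map_mul, map_ofNat, polyX_X]
  refine mem_charIdeal (((isHomogeneous_C_mul_X_mul_X _ _ _).add
    (isHomogeneous_C_mul_X_mul_X _ _ _)).add (isHomogeneous_C_mul_X_mul_X _ _ _))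
    borel_P1_mem ?_ ?_
  · rw [e]
    exact (((OrderLE.ofNat 4).mul ((orderLE_d 0).mul (orderLE_d 1))).add
      (((OrderLE.ofNat 2).mul (orderLE_x 1)).mul ((orderLE_d 0).mul (orderLE_d 2)))).add
      ((orderLE_x 0).mul ((orderLE_d 2).mul (orderLE_d 2)))
  · rw [e, borel_P1, show 4 * (d 0 * d 1) + 2 * x 1 * (d 0 * d 2) + x 0 * (d 2 * d 2) -
      (4 * d 0 * d 1 + 2 * x 1 * d 0 * d 2 + x 0 * d 2 ^ 2) = (0 : DB) by noncomm_ring]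
    exact OrderLE.zero.mono (Nat.zero_le 1)

theorem symbol_borel_P3_mem :
    (MvPolynomial.C 1 * (ξ₁ * ξ₂) - MvPolynomial.C 1 * (ξ₀ * ξ₀) : Symbols 3) ∈
      charIdeal (n := 3) ({IB.mkQ 1} : Set MB) := by
  have e : normalOrder (MvPolynomial.C 1 * (ξ₁ * ξ₂) - MvPolynomial.C 1 * (ξ₀ * ξ₀)) =
      d 1 * d 2 - d 0 * d 0 := by
    simp only [normalOrder_sub, normalOrder_C_mul_X_mul_X]
    simp only [map_one, one_mul]
  refine mem_charIdeal ((isHomogeneous_C_mul_X_mul_X _ _ _).sub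
    (isHomogeneous_C_mul_X_mul_X _ _ _)) borel_P3_mem ?_ ?_
  · rw [e]
    exact ((orderLE_d 1).mul (orderLE_d 2)).sub ((orderLE_d 0).mul (orderLE_d 0))
  · rw [e, borel_P3, pow_two, sub_self]
    exact OrderLE.zero.mono (Nat.zero_le 1)

theorem symbol_borel_P2_mem :
    (MvPolynomial.C 4 * (ξ₁ * ξ₁) + MvPolynomial.C X₀ * (ξ₀ * ξ₂) +
      MvPolynomial.C (2 * X₁) * (ξ₁ * ξ₂) : Symbols 3) ∈
      charIdeal (n := 3) ({IB.mkQ 1} : Set MB) := by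
  have e : normalOrder (MvPolynomial.C 4 * (ξ₁ * ξ₁) + MvPolynomial.C X₀ * (ξ₀ * ξ₂) +
      MvPolynomial.C (2 * X₁) * (ξ₁ * ξ₂)) =
      4 * (d 1 * d 1) + x 0 * (d 0 * d 2) + 2 * x 1 * (d 1 * d 2) := by
    simp only [normalOrder_add, normalOrder_C_mul_X_mul_X]
    simp only [map_mul, map_ofNat, polyX_X]
  refine mem_charIdeal (((isHomogeneous_C_mul_X_mul_X _ _ _).add
    (isHomogeneous_C_mul_X_mul_X _ _ _)).add (isHomogeneous_C_mul_X_mul_X _ _ _))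
    borel_P2_mem ?_ ?_
  · rw [e]
    exact (((OrderLE.ofNat 4).mul ((orderLE_d 1).mul (orderLE_d 1))).add
      ((orderLE_x 0).mul ((orderLE_d 0).mul (orderLE_d 2)))).add
      (((OrderLE.ofNat 2).mul (orderLE_x 1)).mul ((orderLE_d 1).mul (orderLE_d 2)))
  · rw [e, borel_P2, show 4 * (d 1 * d 1) + x 0 * (d 0 * d 2) + 2 * x 1 * (d 1 * d 2) -
      (4 * d 1 ^ 2 + x 0 * d 0 * d 2 + 2 * x 1 * d 1 * d 2 + d 2) = (-d 2 : DB) by noncomm_ring]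
    exact (orderLE_d 2).neg

theorem symbol_borel_P4_mem :
    (MvPolynomial.C (3 * X₀) * ξ₀ + MvPolynomial.C (2 * X₁) * ξ₁ +
      MvPolynomial.C (4 * X₂) * ξ₂ : Symbols 3) ∈ charIdeal (n := 3) ({IB.mkQ 1} : Set MB) := by
  have e : normalOrder (MvPolynomial.C (3 * X₀) * ξ₀ + MvPolynomial.C (2 * X₁) * ξ₁ +
      MvPolynomial.C (4 * X₂) * ξ₂) = 3 * x 0 * d 0 + 2 * x 1 * d 1 + 4 * x 2 * d 2 := by
    simp only [normalOrder_add, normalOrder_C_mul_X]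
    simp only [map_mul, map_ofNat, polyX_X]
  have o : ∀ (i : Fin 3) (r : ℕ) [r.AtLeastTwo],
      OrderLE 1 (OfNat.ofNat r * x i * d i : D) := fun i r _ =>
    ((OrderLE.ofNat r).mul (orderLE_x i)).mul (orderLE_d i)
  refine mem_charIdeal (((isHomogeneous_C_mul_X _ _).add (isHomogeneous_C_mul_X _ _)).add
    (isHomogeneous_C_mul_X _ _)) borel_P4_mem ?_ ?_
  · rw [e]
    exact ((o 0 3).add (o 1 2)).add (o 2 4)
  · rw [e, borel_P4, sub_add_cancel_left]
    exact (OrderLE.ofNat 3).neg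

/-- If `ξ₂` is invertible, then the equations of the characteristic variety of `M_B` imply that all
coordinates are integral over the ring of polynomials in `x₁, y, ξ₂`. -/
theorem isIntegralElem_of_symbol_eqs {A : Type*} [CommRing A] [Algebra ℂ A] {K : Type*} [Field K]
    [Algebra ℂ K] (ι : A →ₐ[ℂ] K) {z0 z1 z2 w0 w1 w2 : A} (h2 : ι w2 ≠ 0)
    (e1 : 4 * (w0 * w1) + 2 * z1 * (w0 * w2) + z0 * (w2 * w2) = 0)
    (e3 : w1 * w2 - w0 * w0 = 0) (e4 : 3 * z0 * w0 + 2 * z1 * w1 + 4 * z2 * w2 = 0) :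
    ∀ s : K, s = ι z0 ∨ s = ι w0 ∨ s = ι w1 →
      ((ι : A →+* K).comp (MvPolynomial.aeval ![z1, z2, w2] :
        MvPolynomial (Fin 3) ℂ →ₐ[ℂ] A).toRingHom).IsIntegralElem s := by
  set f := (ι : A →+* K).comp (MvPolynomial.aeval ![z1, z2, w2] :
        MvPolynomial (Fin 3) ℂ →ₐ[ℂ] A).toRingHom with hf
  have f0 : f X₀ = ι z1 := by simp [hf]
  have f1 : f X₁ = ι z2 := by simp [hf]
  have f2 : f X₂ = ι w2 := by simp [hf]
  have fC : ∀ c : ℂ, f (MvPolynomial.C c) = algebraMap ℂ K c := fun c => by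
    simp only [hf, RingHom.comp_apply, AlgHom.toRingHom_eq_coe, RingHom.coe_coe,
      MvPolynomial.aeval_C, AlgHom.commutes]
  have n3 : (3 : K) ≠ 0 := by
    rw [← map_ofNat (algebraMap ℂ K) 3]
    exact (map_ne_zero _).mpr (OfNat.ofNat_ne_zero 3)
  have n4 : (4 : K) ≠ 0 := by
    rw [← map_ofNat (algebraMap ℂ K) 4]
    exact (map_ne_zero _).mpr (OfNat.ofNat_ne_zero 4)
  have k1 := congrArg ι e1
  have k3 := congrArg ι e3
  have k4 := congrArg ι e4
  simp only [map_add, map_sub, map_mul, map_ofNat, map_zero] at k1 k3 k4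
  -- The ratio `u = w0/w2` corresponds to the critical point `t` of the phase: the equations become
  -- `w1 = u²w2`, `z0 = -(4u³ + 2z1u)` and `3u⁴ + z1u² = z2`.
  obtain ⟨u, hu⟩ : ∃ u, ι w0 = u * ι w2 := ⟨ι w0 / ι w2, (div_mul_cancel₀ _ h2).symm⟩
  have r1 : ι w1 = u ^ 2 * ι w2 := by
    refine mul_right_cancel₀ h2 ?_
    rw [hu] at k3
    linear_combination k3
  have r0 : ι z0 = -(4 * u ^ 3 + 2 * ι z1 * u) := by
    refine mul_right_cancel₀ (pow_ne_zero 2 h2) ?_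
    rw [hu, r1] at k1
    linear_combination k1
  have r2 : 3 * u ^ 4 + ι z1 * u ^ 2 - ι z2 = 0 := by
    refine mul_left_cancel₀ n4 (mul_right_cancel₀ h2 ?_)
    rw [hu, r1, r0] at k4
    linear_combination -k4
  -- Dividing the quartic by 3 makes it monic over the polynomials in `z1, z2`; everything else is a
  -- polynomial in `u, z1, w2`.
  have hu_int : f.IsIntegralElem u := by
    refine ⟨Polynomial.X ^ 4 + Polynomial.C (MvPolynomial.C 3⁻¹ * X₀) * Polynomial.X ^ 2 -
      Polynomial.C (MvPolynomial.C 3⁻¹ * X₁), by monicity!, ?_⟩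
    simp only [Polynomial.eval₂_sub, Polynomial.eval₂_add, Polynomial.eval₂_mul,
      Polynomial.eval₂_pow, Polynomial.eval₂_X, Polynomial.eval₂_C, map_mul, f0, f1, fC, map_inv₀,
      map_ofNat]
    field_simp
    linear_combination r2
  have i1 : f.IsIntegralElem (ι z1) := f0 ▸ f.isIntegralElem_map
  have i2 : f.IsIntegralElem (ι w2) := f2 ▸ f.isIntegralElem_map
  have iofNat : ∀ (r : ℕ) [r.AtLeastTwo], f.IsIntegralElem (OfNat.ofNat r) := fun r _ => by
    rw [← map_ofNat f r]
    exact f.isIntegralElem_map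
  have upow : ∀ r : ℕ, f.IsIntegralElem (u ^ r) := fun r => by
    induction r with
    | zero => rw [pow_zero]; exact RingHom.isIntegralElem_one _
    | succ r ih => rw [pow_succ]; exact ih.mul _ hu_int
  rintro s (rfl | rfl | rfl)
  · rw [r0]
    exact (((iofNat 4).mul _ (upow 3)).add _ (((iofNat 2).mul _ i1).mul _ hu_int)).neg
  · rw [hu]
    exact hu_int.mul _ i2
  · rw [r1]
    exact (upow 2).mul _ i2

/-- If `ξ_y` vanishes modulo the prime, then `ξ₁² = ξ₂ξ_y` and the symbol of `P_{2,B}` give the zero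
section. Otherwise the point lies on the conormal variety of the discriminant, which is finite over
the space with coordinates `x₂, y, ξ_y`. -/
theorem ringKrullDim_charIdeal_MB_le :
    ringKrullDim (Symbols 3 ⧸ charIdeal (n := 3) ({IB.mkQ 1} : Set MB)) ≤ (3 : ℕ) := by
  refine ringKrullDim_quotient_le_of_forall_isPrime fun P hP hle => ?_
  let φ : Symbols 3 →ₐ[ℂ] Symbols 3 ⧸ P := Ideal.Quotient.mkₐ ℂ P
  have hφ : Function.Surjective φ := Ideal.Quotient.mkₐ_surjective ℂ P
  have hz : ∀ {p}, p ∈ charIdeal (n := 3) ({IB.mkQ 1} : Set MB) → φ p = 0 := fun hp =>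
    Ideal.Quotient.eq_zero_iff_mem.mpr (hle hp)
  have ne : (4 : Symbols 3 ⧸ P) ≠ 0 := by
    rw [← map_ofNat (algebraMap ℂ (Symbols 3 ⧸ P)) 4]
    exact (map_ne_zero _).mpr (OfNat.ofNat_ne_zero 4)
  have s1 := hz symbol_borel_P1_mem
  have s2 := hz symbol_borel_P2_mem
  have s3 := hz symbol_borel_P3_mem
  have s4 := hz symbol_borel_P4_mem
  simp only [map_add, map_sub, map_mul, map_ofNat, map_one, one_mul] at s1 s2 s3 s4
  by_cases w2 : φ ξ₂ = 0
  · have w0 : φ ξ₀ = 0 := by simpa [w2] using s3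
    have w1 : φ ξ₁ = 0 := by simpa [w2, ne] using s2
    refine ringKrullDim_le_of_isIntegralElem φ hφ (fun i => φ (MvPolynomial.C (MvPolynomial.X i)))
      (fun i => isIntegralElem_aeval _ (Or.inr ⟨i, rfl⟩)) ?_
    intro i
    fin_cases i
    · exact isIntegralElem_aeval _ (Or.inl w0)
    · exact isIntegralElem_aeval _ (Or.inl w1)
    · exact isIntegralElem_aeval _ (Or.inl w2)
  -- Division by `ξ_y` takes place in the fraction field; `pull` brings integrality back to the
  -- domain.
  · let ι : (Symbols 3 ⧸ P) →ₐ[ℂ] FractionRing (Symbols 3 ⧸ P) :=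
      IsScalarTower.toAlgHom ℂ (Symbols 3 ⧸ P) (FractionRing (Symbols 3 ⧸ P))
    have hι : Function.Injective ι := IsFractionRing.injective (Symbols 3 ⧸ P) _
    have key := isIntegralElem_of_symbol_eqs ι ((map_ne_zero_iff ι hι).mpr w2) s1 s3 s4
    have pull : ∀ s, ((ι : Symbols 3 ⧸ P →+* FractionRing (Symbols 3 ⧸ P)).comp
        (MvPolynomial.aeval ![φ (MvPolynomial.C X₁), φ (MvPolynomial.C X₂), φ ξ₂] :
          MvPolynomial (Fin 3) ℂ →ₐ[ℂ] Symbols 3 ⧸ P).toRingHom).IsIntegralElem (ι s) →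
        (MvPolynomial.aeval ![φ (MvPolynomial.C X₁), φ (MvPolynomial.C X₂), φ ξ₂] :
          MvPolynomial (Fin 3) ℂ →ₐ[ℂ] Symbols 3 ⧸ P).toRingHom.IsIntegralElem s := fun s hs =>
      RingHom.IsIntegralElem.of_comp_injective
        (ι := (ι : Symbols 3 ⧸ P →+* FractionRing (Symbols 3 ⧸ P))) hι hs
    refine ringKrullDim_le_of_isIntegralElem φ hφ
      ![φ (MvPolynomial.C X₁), φ (MvPolynomial.C X₂), φ ξ₂] ?_ ?_
    · intro i
      fin_cases i
      · exact pull _ (key _ (Or.inl rfl))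
      · exact isIntegralElem_aeval _ (Or.inr ⟨0, rfl⟩)
      · exact isIntegralElem_aeval _ (Or.inr ⟨1, rfl⟩)
    · intro i
      fin_cases i
      · exact pull _ (key _ (Or.inr (Or.inl rfl)))
      · exact pull _ (key _ (Or.inr (Or.inr rfl)))
      · exact isIntegralElem_aeval _ (Or.inr ⟨2, rfl⟩)

end CharIdeal

theorem isHolonomic_MB : IsHolonomic 3 MB :=
  isHolonomic_quotient (eq_zero_of_polyX_mem basisOps_independent_IB (j := 0) rfl)
    ringKrullDim_charIdeal_MB_le

end Pearcey

theorem mainTheorem5 :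
    (WeylAlgebra.IsHolonomic 3 Pearcey.M ∧ WeylAlgebra.holonomicRank 3 Pearcey.M = 3) ∧
    (WeylAlgebra.IsHolonomic 3 Pearcey.MB ∧ WeylAlgebra.holonomicRank 3 Pearcey.MB = 3) :=
  ⟨⟨Pearcey.isHolonomic_M, Pearcey.holonomicRank_M⟩,
    ⟨Pearcey.isHolonomic_MB, Pearcey.holonomicRank_MB⟩⟩
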